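/- Setting. Let $D\subset\mathbb R^P$ be compact and $A(\mu)=\theta_1(\mu)A_1+\dots+\theta_Q(\mu)A_Q$ for $\mu\in D$, with Hermitian $A_1,\dots,A_Q\in\mathbb C^{N\times N}$ and $\theta=(\theta_1,\dots,\theta_Q)^T:D\to\mathbb R^Q$. Let $C_J=\{\mu_1,\dots,\mu_J\}\subset D$ and $1\le r\le\ell<N$. Write $\lambda_j^{(1)}\le\lambda_j^{(2)}\le\cdots$ for the eigenvalues of $A(\mu_j)$, counted with multiplicity, and $\lambda_j=\lambda_j^{(1)}$. Let $V_j\in\mathbb C^{N\times\ell}$ have orthonormal columns that are eigenvectors of $A(\mu_j)$ belonging to $\lambda_j^{(1)},\dots,\lambda_j^{(\ell)}$, and let the columns of $V$ be an orthonormal basis of the span $\mathcal V$ of all columns of $V_1,\dots,V_J$. Subspace lower bound. For $\mu\in D$ let $\lambda_{\mathcal V}^{(1)}(\mu)=\lambda_{\min}(V^*A(\mu)V)$, let $w_1,\dots,w_r$ be orthonormal eigenvectors of $V^*A(\mu)V$ belonging to its $r$ smallest eigenvalues, and put $U=V[w_1,\dots,w_r]$ and $\rho=\|A(\mu)U-U(U^*A(\mu)U)\|_2$.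 Let $$\mathcal Y_{LB}=\{y\in\mathbb R^Q:\ \lambda_{\min}(A_q)\le y_q\le\lambda_{\max}(A_q)\ (q=1,\dots,Q),\ \ \theta(\mu_j)^Ty\ge\lambda_j\ (j=1,\dots,J)\},$$ which is assumed to be a simple polytope without degenerate facets, that is, exactly $Q$ of its $2Q+J$ constraints are active at each vertex. Choose a minimizer of $\theta(\mu)^Ty$ over $\mathcal Y_{LB}$ at which $Q$ linearly independent constraints are active, write these as $\Theta y=\psi$, and let $\tilde\psi$ arise from $\psi$ by adding, to each entry that comes from a constraint $\theta(\mu_j)^Ty\ge\lambda_j$, the smallest eigenvalue $\beta_j$ of $$(\Lambda_j-\lambda_jI)-V_j^*UU^*V_j(\Lambda_j-\lambda_j^{(\ell+1)}I),\qquad \Lambda_j=\mathrm{diag}(\lambda_j^{(1)},\dots,\lambda_j^{(\ell)}).$$ With $\eta=\eta(\mu)=\theta(\mu)^T\Theta^{-1}\tilde\psi$, define $$\lambda_{SLB}(\mu;C_J,\ell)=\min\big(\lambda_{\mathcal V}^{(1)},\eta\big)-\frac{2\rho^2}{|\lambda_{\mathcal V}^{(1)}-\eta|+\sqrt{|\lambda_{\mathcal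 V}^{(1)}-\eta|^2+4\rho^2}},$$ the fraction being read as $0$ if its denominator vanishes. All choices involved (the eigenvectors, $w_1,\dots,w_r$ and the active constraints at a minimizer, for each $\mu$) are arbitrary. Theorem. Let $\mu_i\in C_J$ lie in the interior of $D$, let $\theta_1,\dots,\theta_Q$ be differentiable at $\mu_i$, let $\lambda_i=\lambda_{\min}(A(\mu_i))$ be a simple eigenvalue of $A(\mu_i)$, and suppose that $\lambda_i^{(r+1)}>\lambda_i^{(r)}$. Then $\lambda_{SLB}(\mu_i;C_J,\ell)=\lambda_{\min}(A(\mu_i))$, the functions $\mu\mapsto\lambda_{SLB}(\mu;C_J,\ell)$ and $\mu\mapsto\lambda_{\min}(A(\mu))$ are differentiable at $\mu_i$, and $$\nabla\lambda_{SLB}(\mu_i;C_J,\ell)=\nabla\lambda_{\min}(A(\mu_i)).$$ -/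

import Mathlib

open scoped Matrix

noncomputable section

namespace SubspaceSCM

open Classical in
/-- The `k`-th smallest eigenvalue, counted with multiplicity and with `1 ≤ k ≤ n`, of a Hermitian
`n × n` matrix (and `0` outside of this range). Mathlib lists the eigenvalues of a Hermitian matrix
in decreasing order as `eigenvalues₀ 0 ≥ eigenvalues₀ 1 ≥ ⋯`. -/
def eig {n : ℕ} (M : Matrix (Fin n) (Fin n) ℂ) (k : ℕ) : ℝ :=
  if h : M.IsHermitian ∧ 1 ≤ k ∧ k ≤ n then
    h.1.eigenvalues₀ ⟨n - k, by rw [Fintype.card_fin]; omega⟩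
  else 0

/-- `λ_min(M)`. -/
def eigMin {n : ℕ} (M : Matrix (Fin n) (Fin n) ℂ) : ℝ := eig M 1

/-- `λ_max(M)`. -/
def eigMax {n : ℕ} (M : Matrix (Fin n) (Fin n) ℂ) : ℝ := eig M n

/-- `x` is a simple eigenvalue of the Hermitian matrix `M`: its eigenspace is a line. -/
def IsSimpleEigenvalue {n : ℕ} (M : Matrix (Fin n) (Fin n) ℂ) (x : ℝ) : Prop :=
  Module.finrank ℂ (Module.End.eigenspace (Matrix.toLin' M) (x : ℂ)) = 1

/-- The columns of `X` are orthonormal eigenvectors of `M` belonging, in this order, to the `m`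
smallest eigenvalues of `M`. -/
def IsLowestEigenbasis {n m : ℕ} (M : Matrix (Fin n) (Fin n) ℂ) (X : Matrix (Fin n) (Fin m) ℂ) :
    Prop :=
  Xᴴ * X = 1 ∧ M * X = X * Matrix.diagonal fun j : Fin m => (eig M (j + 1) : ℂ)

/-- The spectral norm (operator norm with respect to the Euclidean norms). -/
def specNorm {m n : ℕ} (M : Matrix (Fin m) (Fin n) ℂ) : ℝ :=
  ‖LinearMap.toContinuousLinearMap (Matrix.toEuclideanLin M)‖

/-- The smallest eigenvalue of a (not necessarily Hermitian) square matrix with real spectrum. -/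
def minRealEigenvalue {m : ℕ} (M : Matrix (Fin m) (Fin m) ℂ) : ℝ :=
  sInf {b : ℝ | (b : ℂ) ∈ spectrum ℂ M}

/-- `c₁ A₁ + ⋯ + c_Q A_Q`; thus `A(μ) = affine a (θ μ)`. -/
def affine {N Q : ℕ} (a : Fin Q → Matrix (Fin N) (Fin N) ℂ) (c : Fin Q → ℝ) :
    Matrix (Fin N) (Fin N) ℂ :=
  ∑ q, (c q : ℂ) • a q

/-! ### The linear program of the successive constraint method

In this part `t j` stands for the vector `θ(μ_j)` and `c` for `θ(μ)`. -/

/-- The polytope `Y_LB(C_J)`: the `y` in the bounding box with `θ(μ_j)ᵀ y ≥ λ_min(A(μ_j))` for every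
sample `μ_j`. -/
def polytope {N Q J : ℕ} (a : Fin Q → Matrix (Fin N) (Fin N) ℂ) (t : Fin J → Fin Q → ℝ) :
    Set (Fin Q → ℝ) :=
  {y | (∀ q, eigMin (a q) ≤ y q ∧ y q ≤ eigMax (a q)) ∧
    ∀ j, eigMin (affine a (t j)) ≤ t j ⬝ᵥ y}

/-- The `2Q + J` constraints of the linear program: lower box constraints, upper box constraints,
sample constraints. Each is written `normal k ⬝ᵥ y ≥ rhs k`. -/
abbrev Constraint (Q J : ℕ) : Type := Fin Q ⊕ Fin Q ⊕ Fin J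

/-- Normal vectors of the constraints. -/
def normal {Q J : ℕ} (t : Fin J → Fin Q → ℝ) : Constraint Q J → Fin Q → ℝ
  | .inl q => Pi.single q 1
  | .inr (.inl q) => -Pi.single q 1
  | .inr (.inr j) => t j

/-- Right-hand sides of the constraints. -/
def rhs {N Q J : ℕ} (a : Fin Q → Matrix (Fin N) (Fin N) ℂ) (t : Fin J → Fin Q → ℝ) :
    Constraint Q J → ℝ
  | .inl q => eigMin (a q)
  | .inr (.inl q) => -eigMax (a q)
  | .inr (.inr j) => eigMin (affine a (t j))

theorem mem_polytope_iff {N Q J : ℕ} (a : Fin Q → Matrix (Fin N) (Fin N) ℂ)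
    (t : Fin J → Fin Q → ℝ) (y : Fin Q → ℝ) :
    y ∈ polytope a t ↔ ∀ k, rhs a t k ≤ normal t k ⬝ᵥ y := by
  simp [polytope, Sum.forall, rhs, normal, forall_and, and_assoc]

/-- `Y_LB(C_J)` is a simple polytope without degenerate facets: at each of its vertices exactly `Q`
of the `2Q + J` constraints are active. -/
def IsSimplePolytope {N Q J : ℕ} (a : Fin Q → Matrix (Fin N) (Fin N) ℂ) (t : Fin J → Fin Q → ℝ) :
    Prop :=
  ∀ y ∈ Set.extremePoints ℝ (polytope a t),
    {k : Constraint Q J | normal t k ⬝ᵥ y = rhs a t k}.ncard = Q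

/-- `s` lists `Q` linearly independent constraints that are active at some minimizer `y` of
`cᵀ y` over `Y_LB(C_J)`. -/
def IsOptimalActiveSet {N Q J : ℕ} (a : Fin Q → Matrix (Fin N) (Fin N) ℂ) (t : Fin J → Fin Q → ℝ)
    (c : Fin Q → ℝ) (s : Fin Q → Constraint Q J) : Prop :=
  ∃ y ∈ polytope a t, (∀ z ∈ polytope a t, c ⬝ᵥ y ≤ c ⬝ᵥ z) ∧
    (∀ k, normal t (s k) ⬝ᵥ y = rhs a t (s k)) ∧
    LinearIndependent ℝ fun k => normal t (s k)

/-! ### The subspace lower bound -/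

/-- The columns of `V` form an orthonormal basis of `𝒱(C_J, ℓ)`, the span of all columns of the
matrices `X j` of sampled eigenvectors. -/
def IsOrthonormalBasisOfSamples {N J l d : ℕ} (X : Fin J → Matrix (Fin N) (Fin l) ℂ)
    (V : Matrix (Fin N) (Fin d) ℂ) : Prop :=
  Vᴴ * V = 1 ∧
    Submodule.span ℂ (Set.range V.col) = Submodule.span ℂ (⋃ j, Set.range (X j).col)

/-- `β`, for `M = A(μ_j)`, the matrix `X` of its `ℓ` lowest eigenvectors and an orthonormal basis `U`
of the Ritz subspace: the smallest eigenvalue of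
`(Λ - λ⁽¹⁾ I) - Xᴴ U Uᴴ X (Λ - λ⁽ˡ⁺¹⁾ I)` with `Λ = diag(λ⁽¹⁾, …, λ⁽ˡ⁾)`. -/
def beta {N l r : ℕ} (M : Matrix (Fin N) (Fin N) ℂ) (X : Matrix (Fin N) (Fin l) ℂ)
    (U : Matrix (Fin N) (Fin r) ℂ) : ℝ :=
  minRealEigenvalue
    ((Matrix.diagonal fun k : Fin l => ((eig M (k + 1) - eig M 1 : ℝ) : ℂ)) -
      Xᴴ * U * Uᴴ * X *
        Matrix.diagonal fun k : Fin l => ((eig M (k + 1) - eig M (l + 1) : ℝ) : ℂ))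

/-- The updated right-hand sides: `λ_min(A(μ_j)) + β_j` for the sample constraints, unchanged for
the box constraints. -/
def updatedRhs {N Q J l r : ℕ} (a : Fin Q → Matrix (Fin N) (Fin N) ℂ) (t : Fin J → Fin Q → ℝ)
    (X : Fin J → Matrix (Fin N) (Fin l) ℂ) (U : Matrix (Fin N) (Fin r) ℂ) :
    Constraint Q J → ℝ
  | .inl q => rhs a t (.inl q)
  | .inr (.inl q) => rhs a t (.inr (.inl q))
  | .inr (.inr j) => rhs a t (.inr (.inr j)) + beta (affine a (t j)) (X j) U

/-- `η = cᵀ Θ⁻¹ ψ̃`, where the rows of `Θ` are the normals of the active constraints listed by `s`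
and `ψ̃` holds their updated right-hand sides. -/
def eta {N Q J l r : ℕ} (a : Fin Q → Matrix (Fin N) (Fin N) ℂ) (t : Fin J → Fin Q → ℝ)
    (X : Fin J → Matrix (Fin N) (Fin l) ℂ) (U : Matrix (Fin N) (Fin r) ℂ)
    (s : Fin Q → Constraint Q J) (c : Fin Q → ℝ) : ℝ :=
  c ⬝ᵥ ((Matrix.of fun k => normal t (s k))⁻¹ *ᵥ fun k => updatedRhs a t X U (s k))

/-- The residual norm `ρ = ‖M U - U (Uᴴ M U)‖₂`. -/
def rho {N r : ℕ} (M : Matrix (Fin N) (Fin N) ℂ) (U : Matrix (Fin N) (Fin r) ℂ) : ℝ :=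
  specNorm (M * U - U * (Uᴴ * M * U))

/-- The subspace lower bound `λ_SLB(μ; C_J, ℓ)`, formed with `λ_𝒱⁽¹⁾ = λ_min(Vᴴ A(μ) V)`, the
orthonormal basis `U = V W(μ)` of the Ritz subspace, and the active constraints `s μ` at a minimizer
of the linear program for `θ(μ)`. -/
def lambdaSLB {P N Q J l r d : ℕ} (a : Fin Q → Matrix (Fin N) (Fin N) ℂ)
    (θ : EuclideanSpace ℝ (Fin P) → Fin Q → ℝ) (sample : Fin J → EuclideanSpace ℝ (Fin P))
    (X : Fin J → Matrix (Fin N) (Fin l) ℂ) (V : Matrix (Fin N) (Fin d) ℂ)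
    (W : EuclideanSpace ℝ (Fin P) → Matrix (Fin d) (Fin r) ℂ)
    (s : EuclideanSpace ℝ (Fin P) → Fin Q → Constraint Q J)
    (μ : EuclideanSpace ℝ (Fin P)) : ℝ :=
  let M := affine a (θ μ)
  let U := V * W μ
  let ritz := eigMin (Vᴴ * M * V)
  let η := eta a (fun j => θ (sample j)) X U (s μ) (θ μ)
  let ρ := rho M U
  min ritz η - 2 * ρ ^ 2 / (|ritz - η| + √(|ritz - η| ^ 2 + 4 * ρ ^ 2))

end SubspaceSCM

end

/-!
Let `B = A(μ_i)`, let `v` be the eigenvector of its simple lowest eigenvalue `λ_i`, and let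
`f(μ) = vᴴ A(μ) v = θ(μ)ᵀ z` with `z_q = vᴴ A_q v`. This function is differentiable at `μ_i` and
`f(μ_i) = λ_i`. Both `λ_min(A(μ))` and `λ_SLB(μ)` differ from `f(μ)` by `O(‖A(μ) - B‖²)`, hence by
`O(‖μ - μ_i‖²)`, so all three functions share value and derivative at `μ_i`
(`exists_sq_error`, `eq_and_hasFDerivAt_of_sq_error`).

The perturbation theory rests on a quantitative Ky Fan inequality (`gap_mul_norm_sq_le`): for an
orthonormal frame `Y` of rank `r`, the excess of `tr (B Y Yᴴ)` over the sum of the `r` lowest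
eigenvalues is at least half the gap `λ⁽ʳ⁺¹⁾ - λ⁽ʳ⁾` times the squared Frobenius distance of `Y Yᴴ`
to the spectral projector. As eigenframes and Ritz frames minimize the Rayleigh trace, their
projectors move by `O(‖A(μ) - B‖)` only, and their Rayleigh traces by `O(‖A(μ) - B‖²)`
(`exists_perturbation_bound`). With rank one this gives the claim on `λ_min`, and on the Ritz value
`λ_𝒱⁽¹⁾`, which lies between `λ_min(A(μ))` and `f(μ)` because `v` lies in the subspace. With
rank `r` it gives `U Uᴴ → P₀`, the projector on the `r` lowest eigenvectors of `B`, and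
`ρ = O(‖A(μ) - B‖)` (`exists_rho_le`).

What is left is that the correction term is `O(ρ²)`, for which `η - λ_𝒱⁽¹⁾` has to stay away from
zero. For `U Uᴴ = P₀` the matrix that defines `β_i` is diagonal with entries at least
`λ⁽²⁾ - λ⁽¹⁾ > 0`, and this survives a small change of `U Uᴴ` (`le_beta`). Since there are finitely
many active sets, those chosen near `μ_i` are optimal for `θ(μ_i)` too; as `z` is feasible with
`θ(μ_i)ᵀ z = λ_i`, the constraint `i` is active at the corresponding vertices, and by simplicity of
the polytope it is one of the listed constraints. Hence `θ(μ)ᵀ Θ⁻¹` tends to a unit vector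
that picks `λ_i + β_i`, so that `η` stays above `λ_i + δ` (`eventually_le_eta`).
-/

namespace SubspaceSCM

open Matrix

/-! ### Spectral facts for Hermitian matrices -/

section Spectral

attribute [local instance] Matrix.frobeniusNormedAddCommGroup Matrix.frobeniusNormedSpace

theorem eig_le_eig {n : ℕ} {B : Matrix (Fin n) (Fin n) ℂ} (hB : B.IsHermitian) {j k : ℕ}
    (hj : 1 ≤ j) (hjk : j ≤ k) (hk : k ≤ n) : eig B j ≤ eig B k := by
  rw [eig, eig, dif_pos ⟨hB, hj, hjk.trans hk⟩, dif_pos ⟨hB, hj.trans hjk, hk⟩]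
  apply hB.eigenvalues₀_antitone
  rw [Fin.mk_le_mk]
  omega

/-- A full eigenbasis in increasing order; its first `r` columns are a lowest eigenbasis. -/
theorem exists_isLowestEigenbasis {n : ℕ} {B : Matrix (Fin n) (Fin n) ℂ} (hB : B.IsHermitian) :
    ∃ T : Matrix (Fin n) (Fin n) ℂ, IsLowestEigenbasis B T := by
  let σ : Fin n → Fin n := fun k =>
    Fintype.equivOfCardEq (Fintype.card_fin _)
      (⟨n - (k + 1), by rw [Fintype.card_fin]; omega⟩ : Fin (Fintype.card (Fin n)))
  have hσ : Function.Injective σ := by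
    intro k k' h
    have := Fin.mk.inj_iff.1 (Equiv.injective _ h)
    omega
  have hev : ∀ k, hB.eigenvalues (σ k) = eig B (k + 1) := by
    intro k
    rw [eig, dif_pos ⟨hB, by omega, by omega⟩, IsHermitian.eigenvalues, Equiv.symm_apply_apply]
  refine ⟨(hB.eigenvectorUnitary : Matrix (Fin n) (Fin n) ℂ).submatrix id σ, ?_, ?_⟩
  · rw [conjTranspose_submatrix, ← submatrix_mul _ _ σ id σ Function.bijective_id,
      ← star_eq_conjTranspose, Unitary.coe_star_mul_self, submatrix_one _ hσ]
  · ext p k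
    have := congrFun (hB.mulVec_eigenvectorBasis (σ k)) p
    rw [mul_diagonal, ← hev]
    simpa [Matrix.mul_apply, mulVec, dotProduct, mul_comm] using this

theorem frobenius_norm_sq {m n : Type*} [Fintype m] [Fintype n] (Z : Matrix m n ℂ) :
    ‖Z‖ ^ 2 = ∑ i, ∑ j, ‖Z i j‖ ^ 2 := by
  rw [frobenius_norm_def, ← Real.sqrt_eq_rpow, Real.sq_sqrt (by positivity)]
  norm_cast

theorem re_trace_conjTranspose_mul_self {m n : Type*} [Fintype m] [Fintype n]
    (Z : Matrix m n ℂ) : (Zᴴ * Z).trace.re = ‖Z‖ ^ 2 := by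
  rw [frobenius_norm_sq, Finset.sum_comm]
  simp [trace, Matrix.mul_apply, Complex.mul_re, Complex.sq_norm, Complex.normSq_apply]

/-- The Rayleigh trace of a frame in terms of its coefficients in an eigenbasis. -/
theorem re_trace_eq_sum {n : ℕ} {ι : Type*} [Fintype ι] {B T : Matrix (Fin n) (Fin n) ℂ}
    (hT : IsLowestEigenbasis B T) (Y : Matrix (Fin n) ι ℂ) :
    (B * (Y * Yᴴ)).trace.re = ∑ k : Fin n, eig B (k + 1) * ∑ j, ‖(Tᴴ * Y) k j‖ ^ 2 := by
  have hT' : T * Tᴴ = 1 := mul_eq_one_comm.1 hT.1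
  have hB : B = T * diagonal (fun k : Fin n => (eig B (k + 1) : ℂ)) * Tᴴ := by
    rw [← hT.2, Matrix.mul_assoc, hT', Matrix.mul_one]
  have h1 : (B * (Y * Yᴴ)).trace =
      (diagonal (fun k : Fin n => (eig B (k + 1) : ℂ)) * ((Tᴴ * Y) * (Tᴴ * Y)ᴴ)).trace := by
    conv_lhs => rw [hB]
    rw [conjTranspose_mul, conjTranspose_conjTranspose, Matrix.mul_assoc, Matrix.mul_assoc,
      trace_mul_comm]
    simp only [Matrix.mul_assoc]
  rw [h1]
  simp only [trace, diag_apply, diagonal_mul, Complex.re_sum, Complex.re_ofReal_mul]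
  refine Finset.sum_congr rfl fun k _ => ?_
  congr 1
  generalize Tᴴ * Y = Z
  simp [Matrix.mul_apply, Complex.sq_norm, Complex.normSq_apply]

theorem IsLowestEigenbasis.trace_re {n r : ℕ} {B : Matrix (Fin n) (Fin n) ℂ}
    {Y : Matrix (Fin n) (Fin r) ℂ} (hY : IsLowestEigenbasis B Y) :
    (B * (Y * Yᴴ)).trace.re = ∑ j : Fin r, eig B (j + 1) := by
  rw [← Matrix.mul_assoc, hY.2, Matrix.mul_assoc, trace_mul_comm, Matrix.mul_assoc, hY.1,
    Matrix.mul_one, trace_diagonal]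
  simp

theorem IsLowestEigenbasis.castLE {n r m : ℕ} {B : Matrix (Fin n) (Fin n) ℂ}
    {X : Matrix (Fin n) (Fin m) ℂ} (hX : IsLowestEigenbasis B X) (h : r ≤ m) :
    IsLowestEigenbasis B (X.submatrix id (Fin.castLE h)) := by
  refine ⟨?_, ?_⟩
  · rw [conjTranspose_submatrix, ← submatrix_mul _ _ _ id _ Function.bijective_id, hX.1,
      submatrix_one _ (Fin.castLE_injective h)]
  · ext p k
    have := congrFun (congrFun hX.2 p) (Fin.castLE h k)
    rw [mul_diagonal] at this ⊢
    simpa [Matrix.mul_apply] using this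

theorem sum_fin_eq_sum_ite {n r : ℕ} (h : r ≤ n) (f : ℕ → ℝ) :
    ∑ j : Fin r, f j = ∑ k : Fin n, if (k : ℕ) < r then f k else 0 := by
  rw [Fin.sum_univ_eq_sum_range (fun k => if k < r then f k else 0) n,
    Fin.sum_univ_eq_sum_range f r, ← Finset.sum_filter]
  congr 1
  ext k
  simp only [Finset.mem_range, Finset.mem_filter]
  omega

/-- The rows of an isometry have norm at most one: with `G = Z Zᴴ` a projector,
`G k k = ∑ j, ‖G k j‖² ≥ (G k k)²`. -/
theorem sum_row_le_one {n : ℕ} {ι : Type*} [Fintype ι] [DecidableEq ι] {Z : Matrix (Fin n) ι ℂ}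
    (hZ : Zᴴ * Z = 1) (k : Fin n) : ∑ j, ‖Z k j‖ ^ 2 ≤ 1 := by
  have hG : (Z * Zᴴ) * (Z * Zᴴ)ᴴ = Z * Zᴴ := by
    rw [conjTranspose_mul, conjTranspose_conjTranspose, Matrix.mul_assoc, ← Matrix.mul_assoc Zᴴ,
      hZ, Matrix.one_mul]
  have hd : ((Z * Zᴴ) k k) = ((∑ j, ‖Z k j‖ ^ 2 : ℝ) : ℂ) := by
    simp [Matrix.mul_apply, Complex.mul_conj, Complex.normSq_eq_norm_sq]
  have hk := congrFun (congrFun hG k) k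
  rw [Matrix.mul_apply, hd] at hk
  have hk' : ∑ j, ‖(Z * Zᴴ) k j‖ ^ 2 = ∑ j, ‖Z k j‖ ^ 2 := by
    have := congrArg Complex.re hk
    rw [Complex.ofReal_re] at this
    rw [← this]
    simp [Complex.sq_norm, Complex.normSq_apply]
  have h1 : ‖(Z * Zᴴ) k k‖ ^ 2 ≤ ∑ j, ‖(Z * Zᴴ) k j‖ ^ 2 :=
    Finset.single_le_sum (f := fun j => ‖(Z * Zᴴ) k j‖ ^ 2) (fun _ _ => by positivity)
      (Finset.mem_univ k)
  rw [hk', hd, Complex.norm_real, Real.norm_eq_abs, sq_abs] at h1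
  have h0 : 0 ≤ ∑ j, ‖Z k j‖ ^ 2 := by positivity
  nlinarith

/-- For orthonormal frames `Y`, `Z` of the same rank, the squared distance of the projectors. -/
theorem norm_sub_projector_sq {n r : ℕ} {Y Z : Matrix (Fin n) (Fin r) ℂ} (hY : Yᴴ * Y = 1)
    (hZ : Zᴴ * Z = 1) : ‖Y * Yᴴ - Z * Zᴴ‖ ^ 2 = 2 * (r - ‖Zᴴ * Y‖ ^ 2) := by
  rw [← re_trace_conjTranspose_mul_self, ← re_trace_conjTranspose_mul_self]
  have e : (Y * Yᴴ - Z * Zᴴ)ᴴ * (Y * Yᴴ - Z * Zᴴ) =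
      Y * Yᴴ + Z * Zᴴ - Y * (Yᴴ * Z * Zᴴ) - Z * (Zᴴ * Y * Yᴴ) := by
    simp only [conjTranspose_sub, conjTranspose_mul, conjTranspose_conjTranspose, Matrix.sub_mul,
      Matrix.mul_sub, Matrix.mul_assoc]
    simp only [← Matrix.mul_assoc Yᴴ Y, ← Matrix.mul_assoc Zᴴ Z, hY, hZ, Matrix.one_mul]
    abel
  rw [e]
  have t1 : (Y * Yᴴ).trace = r := by rw [trace_mul_comm, hY]; simp
  have t2 : (Z * Zᴴ).trace = r := by rw [trace_mul_comm, hZ]; simp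
  have t3 : (Y * (Yᴴ * Z * Zᴴ)).trace = ((Zᴴ * Y)ᴴ * (Zᴴ * Y)).trace := by
    rw [trace_mul_comm]; simp [Matrix.mul_assoc]
  have t4 : (Z * (Zᴴ * Y * Yᴴ)).trace = ((Zᴴ * Y)ᴴ * (Zᴴ * Y)).trace := by
    rw [trace_mul_comm ((Zᴴ * Y)ᴴ), trace_mul_comm]; simp [Matrix.mul_assoc]
  rw [trace_sub, trace_sub, trace_add, t1, t2, t3, t4]
  simp only [Complex.add_re, Complex.sub_re, Complex.natCast_re]
  ring

/-- The common core of the Ky Fan inequality and of its quantitative version: if the `r` lowest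
eigenvalues are at most `α` and the others at least `β`, the Rayleigh trace of an orthonormal frame
exceeds the sum of the `r` lowest eigenvalues by `β - α` times the weight of the frame on the other
eigenvectors. -/
theorem sum_eig_add_le_trace {n r : ℕ} (hr : r ≤ n) {B T : Matrix (Fin n) (Fin n) ℂ}
    (hT : IsLowestEigenbasis B T) {Y : Matrix (Fin n) (Fin r) ℂ} (hY : Yᴴ * Y = 1) {α β : ℝ}
    (hα : ∀ k < r, eig B (k + 1) ≤ α) (hβ : ∀ k, r ≤ k → k < n → β ≤ eig B (k + 1)) :
    ∑ j : Fin r, eig B (j + 1) +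
        (β - α) * (r - ‖(T.submatrix id (Fin.castLE hr))ᴴ * Y‖ ^ 2) ≤
      (B * (Y * Yᴴ)).trace.re := by
  have hZ : (Tᴴ * Y)ᴴ * (Tᴴ * Y) = 1 := by
    rw [conjTranspose_mul, conjTranspose_conjTranspose, Matrix.mul_assoc, ← Matrix.mul_assoc T,
      mul_eq_one_comm.1 hT.1, Matrix.one_mul, hY]
  set p : Fin n → ℝ := fun k => ∑ j, ‖(Tᴴ * Y) k j‖ ^ 2 with hp
  have hp0 : ∀ k, 0 ≤ p k := fun k => by positivity
  have hp1 : ∀ k, p k ≤ 1 := sum_row_le_one hZ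
  have hps : ∑ k, p k = r := by
    rw [← frobenius_norm_sq, ← re_trace_conjTranspose_mul_self, hZ]; simp
  have hS : ‖(T.submatrix id (Fin.castLE hr))ᴴ * Y‖ ^ 2 =
      ∑ k : Fin n, if (k : ℕ) < r then p k else 0 := by
    rw [frobenius_norm_sq]
    have := sum_fin_eq_sum_ite hr (fun k => if h : k < n then p ⟨k, h⟩ else 0)
    simp only [Fin.is_lt, dite_true, Fin.eta] at this
    rw [← this]
    refine Finset.sum_congr rfl fun k _ => ?_
    rw [dif_pos (k.2.trans_le hr), hp]
    simp [Matrix.mul_apply, Fin.castLE]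
  have hone : (r : ℝ) = ∑ k : Fin n, if (k : ℕ) < r then (1 : ℝ) else 0 := by
    rw [← sum_fin_eq_sum_ite hr (fun _ => 1)]; simp
  rw [re_trace_eq_sum hT, hS, sum_fin_eq_sum_ite hr (fun k => eig B (k + 1))]
  have e : (β - α) * ((r : ℝ) - ∑ k : Fin n, if (k : ℕ) < r then p k else 0) =
      ∑ k : Fin n, (α * ((if (k : ℕ) < r then p k else 0) - if (k : ℕ) < r then (1 : ℝ) else 0) +
        β * (p k - if (k : ℕ) < r then p k else 0)) := by
    rw [Finset.sum_add_distrib, ← Finset.mul_sum, ← Finset.mul_sum, Finset.sum_sub_distrib,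
      Finset.sum_sub_distrib, ← hone, hps]
    ring
  rw [e, ← Finset.sum_add_distrib]
  refine Finset.sum_le_sum fun k _ => ?_
  split_ifs with h
  · nlinarith [hα k h, hp1 k]
  · nlinarith [hβ k (not_lt.1 h) k.2, hp0 k]

/-- **Ky Fan**: the sum of the `r` lowest eigenvalues bounds every Rayleigh trace from below. -/
theorem sum_eig_le_trace {n r : ℕ} {B : Matrix (Fin n) (Fin n) ℂ}
    (hB : B.IsHermitian) {Y : Matrix (Fin n) (Fin r) ℂ} (hY : Yᴴ * Y = 1) (hr : r ≤ n) :
    ∑ j : Fin r, eig B (j + 1) ≤ (B * (Y * Yᴴ)).trace.re := by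
  obtain ⟨T, hT⟩ := exists_isLowestEigenbasis hB
  rcases r.eq_zero_or_pos with rfl | hr0
  · have : Y * Yᴴ = 0 := by ext; simp [Matrix.mul_apply]
    simp [this]
  have := sum_eig_add_le_trace hr hT hY (α := eig B r) (β := eig B r)
    (fun k hk => eig_le_eig hB (by omega) (by omega) hr)
    (fun k hk hkn => eig_le_eig hB hr0 (by omega) (by omega))
  simpa using this

/-- Quantitative version of the Ky Fan inequality. -/
theorem gap_mul_norm_sq_le {n r : ℕ} {B : Matrix (Fin n) (Fin n) ℂ}
    (hB : B.IsHermitian) {Y Z : Matrix (Fin n) (Fin r) ℂ} (hY : Yᴴ * Y = 1)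
    (hZ : IsLowestEigenbasis B Z) (hr0 : 1 ≤ r) (hr : r < n) (hgap : eig B r < eig B (r + 1)) :
    (eig B (r + 1) - eig B r) / 2 * ‖Y * Yᴴ - Z * Zᴴ‖ ^ 2 ≤
      (B * (Y * Yᴴ)).trace.re - (B * (Z * Zᴴ)).trace.re := by
  obtain ⟨T, hT⟩ := exists_isLowestEigenbasis hB
  have hTr := hT.castLE hr.le
  have key : ∀ {Y : Matrix (Fin n) (Fin r) ℂ}, Yᴴ * Y = 1 →
      (eig B (r + 1) - eig B r) / 2 * ‖Y * Yᴴ - T.submatrix id (Fin.castLE hr.le) *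
        (T.submatrix id (Fin.castLE hr.le))ᴴ‖ ^ 2 ≤
      (B * (Y * Yᴴ)).trace.re - (B * (Z * Zᴴ)).trace.re := by
    intro Y hY
    have := sum_eig_add_le_trace hr.le hT hY (α := eig B r) (β := eig B (r + 1))
      (fun k hk => eig_le_eig hB (by omega) (by omega) hr.le)
      (fun k hk hkn => eig_le_eig hB (by omega) (by omega) (by omega))
    rw [norm_sub_projector_sq hY hTr.1, hZ.trace_re]
    linarith
  -- the gap forces the two lowest eigenbases to span the same space
  have h0 := key hZ.1
  rw [sub_self] at h0
  have h1 : ‖Z * Zᴴ - T.submatrix id (Fin.castLE hr.le) *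
        (T.submatrix id (Fin.castLE hr.le))ᴴ‖ ^ 2 ≤ 0 := by
    by_contra hc
    nlinarith [mul_pos (sub_pos.2 hgap) (not_le.1 hc)]
  have h2 := norm_eq_zero.1 (pow_eq_zero_iff (two_ne_zero) |>.1 (le_antisymm h1 (by positivity)))
  have h3 := key hY
  rwa [← sub_eq_zero.1 h2] at h3

theorem norm_entry_le {m n : Type*} [Fintype m] [Fintype n] (Z : Matrix m n ℂ) (i : m) (j : n) :
    ‖Z i j‖ ≤ ‖Z‖ := by
  refine le_of_sq_le_sq ?_ (norm_nonneg _)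
  rw [frobenius_norm_sq]
  exact (Finset.single_le_sum (f := fun j => ‖Z i j‖ ^ 2) (fun _ _ => by positivity)
    (Finset.mem_univ j)).trans (Finset.single_le_sum (f := fun i => ∑ j, ‖Z i j‖ ^ 2)
    (fun _ _ => by positivity) (Finset.mem_univ i))

theorem abs_re_trace_le {n : ℕ} (M : Matrix (Fin n) (Fin n) ℂ) : |M.trace.re| ≤ n * ‖M‖ := by
  refine (Complex.abs_re_le_norm _).trans ((norm_sum_le _ _).trans ?_)
  refine (Finset.sum_le_sum fun i _ => norm_entry_le M i i).trans ?_
  simp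

/-- Perturbation of a spectral projector: if the frame `Y` has a Rayleigh trace for `A` at most that
of the lowest eigenframe `Z` of `B`, then both the projectors and the Rayleigh traces are close. -/
theorem exists_perturbation_bound {n r : ℕ} {B : Matrix (Fin n) (Fin n) ℂ}
    (hB : B.IsHermitian) {Z : Matrix (Fin n) (Fin r) ℂ} (hZ : IsLowestEigenbasis B Z)
    (hr0 : 1 ≤ r) (hr : r < n) (hgap : eig B r < eig B (r + 1)) :
    ∃ c : ℝ, 0 ≤ c ∧ ∀ (A : Matrix (Fin n) (Fin n) ℂ) (Y : Matrix (Fin n) (Fin r) ℂ),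
      Yᴴ * Y = 1 → (A * (Y * Yᴴ)).trace.re ≤ (A * (Z * Zᴴ)).trace.re →
      ‖Y * Yᴴ - Z * Zᴴ‖ ≤ c * ‖A - B‖ ∧
        (A * (Z * Zᴴ)).trace.re - (A * (Y * Yᴴ)).trace.re ≤ c * ‖A - B‖ ^ 2 := by
  obtain ⟨c, hc, htr⟩ : ∃ c : ℝ, 0 ≤ c ∧ ∀ M : Matrix (Fin n) (Fin n) ℂ,
      |M.trace.re| ≤ c * ‖M‖ := ⟨n, by positivity, abs_re_trace_le⟩
  set g := (eig B (r + 1) - eig B r) / 2 with hg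
  have hg0 : 0 < g := by linarith
  refine ⟨max (c / g) (c * (c / g)), by positivity, fun A Y hY h => ?_⟩
  have h1 := gap_mul_norm_sq_le hB hY hZ hr0 hr hgap
  rw [← hg] at h1
  set d := Y * Yᴴ - Z * Zᴴ with hd
  have h2 : |((A - B) * d).trace.re| ≤ c * (‖A - B‖ * ‖d‖) :=
    (htr _).trans (mul_le_mul_of_nonneg_left (frobenius_norm_mul _ _) hc)
  have h3 : ((A - B) * d).trace.re = (A * (Y * Yᴴ)).trace.re - (A * (Z * Zᴴ)).trace.re -
      ((B * (Y * Yᴴ)).trace.re - (B * (Z * Zᴴ)).trace.re) := by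
    rw [hd, Matrix.sub_mul, Matrix.mul_sub, Matrix.mul_sub]
    simp [trace_sub]
  have h4 := neg_le_of_abs_le h2
  have h5 : g * ‖d‖ ^ 2 ≤ c * ‖A - B‖ * ‖d‖ := by linarith
  have hd1 : ‖d‖ ≤ c / g * ‖A - B‖ := by
    rcases (norm_nonneg d).eq_or_lt with h0 | h0
    · rw [← h0]; positivity
    · rw [div_mul_eq_mul_div, le_div_iff₀ hg0]
      nlinarith
  refine ⟨hd1.trans (by gcongr; exact le_max_left _ _), ?_⟩
  have h6 : (A * (Z * Zᴴ)).trace.re - (A * (Y * Yᴴ)).trace.re ≤ c * (‖A - B‖ * ‖d‖) := by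
    nlinarith [sq_nonneg ‖d‖]
  calc _ ≤ c * (‖A - B‖ * ‖d‖) := h6
    _ ≤ c * (‖A - B‖ * (c / g * ‖A - B‖)) := by gcongr
    _ = c * (c / g) * ‖A - B‖ ^ 2 := by ring
    _ ≤ _ := by gcongr; exact le_max_right _ _

/-- The second smallest eigenvalue exceeds a simple smallest one. -/
theorem IsSimpleEigenvalue.eig_lt {n : ℕ} {B : Matrix (Fin n) (Fin n) ℂ} (hB : B.IsHermitian)
    (hn : 2 ≤ n) (h : IsSimpleEigenvalue B (eigMin B)) : eig B 1 < eig B 2 := by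
  refine (eig_le_eig hB le_rfl (by omega) hn).lt_of_ne fun he => ?_
  obtain ⟨T, hT⟩ := exists_isLowestEigenbasis hB
  have hT2 := hT.castLE hn
  set Y := T.submatrix id (Fin.castLE hn)
  have hYe : ∀ k, Y.col k ∈ Module.End.eigenspace (Matrix.toLin' B) (eigMin B : ℂ) := by
    intro k
    rw [Module.End.mem_eigenspace_iff]
    ext p
    have := congrFun (congrFun hT2.2 p) k
    rw [mul_diagonal] at this
    have hk : eig B (k + 1) = eigMin B := by
      fin_cases k
      · rfl
      · exact he.symm
    rw [hk] at this
    simpa [Matrix.mul_apply, mulVec, dotProduct, mul_comm] using this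
  have hli : LinearIndependent ℂ (fun k => (⟨Y.col k, hYe k⟩ :
      Module.End.eigenspace (Matrix.toLin' B) (eigMin B : ℂ))) := by
    apply LinearIndependent.of_comp (Submodule.subtype _)
    change LinearIndependent ℂ Y.col
    rw [← Matrix.mulVec_injective_iff]
    intro x y hxy
    have := congrArg (Yᴴ *ᵥ ·) hxy
    simpa [hT2.1] using this
  have := hli.fintype_card_le_finrank
  rw [h] at this
  simp at this

theorem rayleigh_le_eigMax {n : ℕ} {B : Matrix (Fin n) (Fin n) ℂ} (hB : B.IsHermitian)
    {v : Matrix (Fin n) (Fin 1) ℂ} (hv : vᴴ * v = 1) :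
    (B * (v * vᴴ)).trace.re ≤ eigMax B := by
  obtain ⟨T, hT⟩ := exists_isLowestEigenbasis hB
  have hZ : (Tᴴ * v)ᴴ * (Tᴴ * v) = 1 := by
    rw [conjTranspose_mul, conjTranspose_conjTranspose, Matrix.mul_assoc, ← Matrix.mul_assoc T,
      mul_eq_one_comm.1 hT.1, Matrix.one_mul, hv]
  have hs : ∑ k, ∑ j, ‖(Tᴴ * v) k j‖ ^ 2 = 1 := by
    rw [← frobenius_norm_sq, ← re_trace_conjTranspose_mul_self, hZ]; simp
  rw [re_trace_eq_sum hT, ← mul_one (eigMax B), ← hs, Finset.mul_sum]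
  refine Finset.sum_le_sum fun k _ => mul_le_mul_of_nonneg_right ?_ (by positivity)
  exact eig_le_eig hB (by omega) (by omega) le_rfl

theorem eigMin_le_rayleigh {n : ℕ} {B : Matrix (Fin n) (Fin n) ℂ} (hB : B.IsHermitian)
    (hn : 1 ≤ n) {v : Matrix (Fin n) (Fin 1) ℂ} (hv : vᴴ * v = 1) :
    eigMin B ≤ (B * (v * vᴴ)).trace.re := by
  simpa [eigMin] using sum_eig_le_trace hB hv hn

end Spectral

/-! ### Residuals and the eigenvalue shifts `β` -/

section Residual

attribute [local instance] Matrix.frobeniusNormedAddCommGroup Matrix.frobeniusNormedSpace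

theorem norm_toLp_mulVec_le {m n : ℕ} (M : Matrix (Fin m) (Fin n) ℂ) (x : Fin n → ℂ) :
    ‖WithLp.toLp 2 (M *ᵥ x)‖ ≤ ‖M‖ * ‖WithLp.toLp 2 x‖ := by
  rw [← frobenius_norm_replicateCol (ι := Unit) x, ← frobenius_norm_replicateCol (ι := Unit),
    replicateCol_mulVec]
  exact frobenius_norm_mul _ _

theorem specNorm_le_norm {m n : ℕ} (M : Matrix (Fin m) (Fin n) ℂ) : specNorm M ≤ ‖M‖ :=
  ContinuousLinearMap.opNorm_le_bound _ (norm_nonneg _) fun x => norm_toLp_mulVec_le M x.ofLp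

theorem norm_of_orthonormal {n r : ℕ} {U : Matrix (Fin n) (Fin r) ℂ} (hU : Uᴴ * U = 1) :
    ‖U‖ = √r := by
  rw [eq_comm, Real.sqrt_eq_iff_mul_self_eq (by positivity) (norm_nonneg _), ← sq,
    ← re_trace_conjTranspose_mul_self, hU]
  simp

/-- The residual of a frame `U` for `A` is controlled by the distance of `A` to `B` and by the
distance of `U Uᴴ` to the projector on an invariant subspace of `B`. -/
theorem exists_rho_le {n r : ℕ} {B : Matrix (Fin n) (Fin n) ℂ} {Z : Matrix (Fin n) (Fin r) ℂ}
    (hZ : IsLowestEigenbasis B Z) :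
    ∃ c : ℝ, 0 ≤ c ∧ ∀ (A : Matrix (Fin n) (Fin n) ℂ) (U : Matrix (Fin n) (Fin r) ℂ),
      Uᴴ * U = 1 → rho A U ≤ c * (‖A - B‖ + ‖U * Uᴴ - Z * Zᴴ‖) := by
  refine ⟨max (√r + √r * √r * √r) (‖B‖ * √r + ‖B‖ * √r + √r * √r * ‖B‖ * √r), by positivity,
    fun A U hU => (specNorm_le_norm _).trans ?_⟩
  have hinv : B * (Z * Zᴴ) = Z * Zᴴ * B * (Z * Zᴴ) := by
    rw [Matrix.mul_assoc _ B, ← Matrix.mul_assoc B, hZ.2, Matrix.mul_assoc Z Zᴴ,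
      ← Matrix.mul_assoc Zᴴ, ← Matrix.mul_assoc Zᴴ Z, hZ.1, Matrix.one_mul, Matrix.mul_assoc]
  have hPU : U * Uᴴ * U = U := by rw [Matrix.mul_assoc, hU, Matrix.mul_one]
  have hnU := norm_of_orthonormal hU
  have hnP : ‖U * Uᴴ‖ ≤ √r * √r := by
    refine (frobenius_norm_mul _ _).trans ?_
    rw [frobenius_norm_conjTranspose, hnU]
  have hnP0 : ‖Z * Zᴴ‖ ≤ √r * √r := by
    refine (frobenius_norm_mul _ _).trans ?_
    rw [frobenius_norm_conjTranspose, norm_of_orthonormal hZ.1]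
  set P := U * Uᴴ with hP
  set P0 := Z * Zᴴ with hP0
  -- `(1 - P) B U` is compared with `(1 - P₀) B P₀ = 0`, which holds as `range Z` is invariant
  have e : A * U - U * (Uᴴ * A * U) = (A - B) * U - P * ((A - B) * U) +
      (B * ((P - P0) * U) - (P - P0) * (B * U) - P0 * (B * ((P - P0) * U))) := by
    have e1 : U * (Uᴴ * A * U) = P * (A * U) := by rw [hP]; simp only [Matrix.mul_assoc]
    have e2 : P0 * (B * (P0 * U)) = B * (P0 * U) := by
      calc P0 * (B * (P0 * U)) = P0 * B * P0 * U := by simp only [Matrix.mul_assoc]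
        _ = B * (P0 * U) := by rw [← hinv, Matrix.mul_assoc]
    rw [e1]
    simp only [Matrix.sub_mul, Matrix.mul_sub, hPU, e2]
    abel
  have b1 : ‖(A - B) * U‖ ≤ ‖A - B‖ * √r := hnU ▸ frobenius_norm_mul _ _
  have b2 : ‖P * ((A - B) * U)‖ ≤ √r * √r * (‖A - B‖ * √r) :=
    (frobenius_norm_mul _ _).trans (by gcongr)
  have b3 : ‖B * ((P - P0) * U)‖ ≤ ‖B‖ * (‖P - P0‖ * √r) :=
    (frobenius_norm_mul _ _).trans (by gcongr; exact hnU ▸ frobenius_norm_mul _ _)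
  have b4 : ‖(P - P0) * (B * U)‖ ≤ ‖P - P0‖ * (‖B‖ * √r) :=
    (frobenius_norm_mul _ _).trans (by gcongr; exact hnU ▸ frobenius_norm_mul _ _)
  have b5 : ‖P0 * (B * ((P - P0) * U))‖ ≤ √r * √r * (‖B‖ * (‖P - P0‖ * √r)) :=
    (frobenius_norm_mul _ _).trans (by gcongr)
  have htot : ‖A * U - U * (Uᴴ * A * U)‖ ≤ (√r + √r * √r * √r) * ‖A - B‖ +
      (‖B‖ * √r + ‖B‖ * √r + √r * √r * ‖B‖ * √r) * ‖P - P0‖ := by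
    rw [e]
    refine (norm_add_le _ _).trans ?_
    have h1 := norm_sub_le ((A - B) * U) (P * ((A - B) * U))
    have h2 := norm_sub_le (B * ((P - P0) * U) - (P - P0) * (B * U)) (P0 * (B * ((P - P0) * U)))
    have h3 := norm_sub_le (B * ((P - P0) * U)) ((P - P0) * (B * U))
    linarith
  refine htot.trans ?_
  rw [mul_add]
  gcongr
  · exact le_max_left _ _
  · exact le_max_right _ _

theorem exists_eigenvector_of_mem_spectrum {m : ℕ} {K : Matrix (Fin m) (Fin m) ℂ} {b : ℂ}
    (hb : b ∈ spectrum ℂ K) : ∃ x ≠ 0, K *ᵥ x = b • x := by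
  rw [spectrum.mem_iff, isUnit_iff_isUnit_det, isUnit_iff_ne_zero, not_not] at hb
  obtain ⟨x, hx, h⟩ := exists_mulVec_eq_zero_iff.2 hb
  refine ⟨x, hx, ?_⟩
  rw [sub_mulVec, Algebra.algebraMap_eq_smul_one, smul_mulVec, one_mulVec, sub_eq_zero] at h
  exact h.symm

theorem abs_minRealEigenvalue_le {m : ℕ} (K : Matrix (Fin m) (Fin m) ℂ) :
    |minRealEigenvalue K| ≤ ‖K‖ := by
  have hb : ∀ b ∈ {b : ℝ | (b : ℂ) ∈ spectrum ℂ K}, |b| ≤ ‖K‖ := by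
    intro b hb
    obtain ⟨x, hx, h⟩ := exists_eigenvector_of_mem_spectrum hb
    have h1 := norm_toLp_mulVec_le K x
    rw [h, WithLp.toLp_smul, norm_smul, Complex.norm_real, Real.norm_eq_abs] at h1
    exact le_of_mul_le_mul_right h1 (norm_pos_iff.2 (by simpa using hx))
  rw [minRealEigenvalue]
  -- without real eigenvalues the infimum takes the junk value `0`
  rcases Set.eq_empty_or_nonempty {b : ℝ | (b : ℂ) ∈ spectrum ℂ K} with h | h
  · rw [h]; simp
  · obtain ⟨b, hbm⟩ := h
    rw [abs_le]
    exact ⟨le_csInf ⟨b, hbm⟩ fun c hc => neg_le_of_abs_le (hb c hc),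
      (csInf_le ⟨-‖K‖, fun c hc => neg_le_of_abs_le (hb c hc)⟩ hbm).trans (le_of_abs_le (hb b hbm))⟩

/-- The shift `β` is bounded uniformly over all frames `U`. -/
theorem exists_abs_beta_le {n l r : ℕ} (B : Matrix (Fin n) (Fin n) ℂ)
    (X : Matrix (Fin n) (Fin l) ℂ) : ∃ c : ℝ, 0 ≤ c ∧
      ∀ U : Matrix (Fin n) (Fin r) ℂ, Uᴴ * U = 1 → |beta B X U| ≤ c := by
  set D1 : Matrix (Fin l) (Fin l) ℂ :=
    diagonal fun k : Fin l => ((eig B (k + 1) - eig B 1 : ℝ) : ℂ) with hD1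
  set D3 : Matrix (Fin l) (Fin l) ℂ :=
    diagonal fun k : Fin l => ((eig B (k + 1) - eig B (l + 1) : ℝ) : ℂ) with hD3
  refine ⟨‖D1‖ + ‖X‖ * √r * √r * ‖X‖ * ‖D3‖, by positivity, fun U hU => ?_⟩
  have hU' := norm_of_orthonormal hU
  refine (abs_minRealEigenvalue_le _).trans ((norm_sub_le _ _).trans ?_)
  gcongr
  refine (frobenius_norm_mul _ _).trans ?_
  gcongr
  refine (frobenius_norm_mul _ _).trans ?_
  gcongr
  refine (frobenius_norm_mul _ _).trans ?_
  rw [frobenius_norm_conjTranspose, hU']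
  gcongr
  refine (frobenius_norm_mul _ _).trans ?_
  rw [frobenius_norm_conjTranspose, hU']

/-- A product `diag δ + G diag γ` with `γ ≥ 0` and `G` Hermitian has real spectrum although it need
not be Hermitian: pairing the eigenvector equation with `diag γ x` gives each eigenvalue as a
Rayleigh quotient, unless `x` is supported where `γ` vanishes. -/
theorem eigenvalue_of_diagonal_add {m : ℕ} {δ γ : Fin m → ℝ} (hγ : ∀ k, 0 ≤ γ k)
    {G : Matrix (Fin m) (Fin m) ℂ} (hG : G.IsHermitian) {b : ℂ}
    (hb : b ∈ spectrum ℂ (diagonal (fun k => (δ k : ℂ)) + G * diagonal fun k => (γ k : ℂ))) :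
    ∃ β : ℝ, b = β ∧ ((∃ k, γ k = 0 ∧ β = δ k) ∨
      ∃ x : Fin m → ℂ, 0 < ∑ k, γ k * ‖x k‖ ^ 2 ∧
        β * ∑ k, γ k * ‖x k‖ ^ 2 = ∑ k, γ k * δ k * ‖x k‖ ^ 2 +
          (star (fun k => γ k * x k) ⬝ᵥ (G *ᵥ fun k => γ k * x k)).re) := by
  obtain ⟨x, hx, h⟩ := exists_eigenvector_of_mem_spectrum hb
  set y : Fin m → ℂ := fun k => γ k * x k with hy
  have hyx : (diagonal fun k => (γ k : ℂ)) *ᵥ x = y := by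
    ext k; rw [mulVec_diagonal]
  have hk : ∀ k, δ k * x k + (G *ᵥ y) k = b * x k := by
    intro k
    have := congrFun h k
    rwa [add_mulVec, ← mulVec_mulVec, hyx, Pi.add_apply, mulVec_diagonal, Pi.smul_apply,
      smul_eq_mul] at this
  have hm0 : 0 ≤ ∑ k, γ k * ‖x k‖ ^ 2 :=
    Finset.sum_nonneg fun k _ => mul_nonneg (hγ k) (by positivity)
  rcases hm0.eq_or_lt with h0 | hpos
  · have hz : ∀ k, γ k * ‖x k‖ ^ 2 = 0 := fun k =>
      (Finset.sum_eq_zero_iff_of_nonneg fun k _ => mul_nonneg (hγ k) (by positivity)).1 h0.symm k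
        (Finset.mem_univ k)
    have hy0 : y = 0 := by
      ext k
      rcases mul_eq_zero.1 (hz k) with h | h
      · simp [hy, h]
      · simp only [ne_eq, OfNat.ofNat_ne_zero, not_false_eq_true, pow_eq_zero_iff, norm_eq_zero] at h
        simp [hy, h]
    obtain ⟨k, hxk⟩ := Function.ne_iff.1 hx
    have h1 := hk k
    rw [hy0, mulVec_zero, Pi.zero_apply, add_zero] at h1
    refine ⟨δ k, (mul_right_cancel₀ hxk h1).symm, Or.inl ⟨k, ?_, rfl⟩⟩
    rcases mul_eq_zero.1 (hz k) with h | h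
    · exact h
    · simp only [ne_eq, OfNat.ofNat_ne_zero, not_false_eq_true, pow_eq_zero_iff, norm_eq_zero] at h
      exact absurd h hxk
  · have hsum : ((∑ k, γ k * δ k * ‖x k‖ ^ 2 : ℝ) : ℂ) + star y ⬝ᵥ (G *ᵥ y) =
        b * ((∑ k, γ k * ‖x k‖ ^ 2 : ℝ) : ℂ) := by
      rw [dotProduct, Complex.ofReal_sum, Complex.ofReal_sum, Finset.mul_sum,
        ← Finset.sum_add_distrib]
      refine Finset.sum_congr rfl fun k _ => ?_
      have h1 : (star y) k = γ k * star (x k) := by simp [hy]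
      have h2 : ((‖x k‖ : ℂ)) ^ 2 = star (x k) * x k := by
        rw [Complex.star_def, Complex.conj_mul']
      push_cast
      rw [h1, h2]
      linear_combination (γ k : ℂ) * star (x k) * hk k
    have him : (star y ⬝ᵥ (G *ᵥ y)).im = 0 := hG.im_star_dotProduct_mulVec_self y
    have hreal : star y ⬝ᵥ (G *ᵥ y) = ((star y ⬝ᵥ (G *ᵥ y)).re : ℂ) := by
      apply Complex.ext <;> simp [him]
    rw [hreal] at hsum
    set m0 := ∑ k, γ k * ‖x k‖ ^ 2
    set s0 := ∑ k, γ k * δ k * ‖x k‖ ^ 2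
    refine ⟨(s0 + (star y ⬝ᵥ (G *ᵥ y)).re) / m0, ?_, Or.inr ⟨x, hpos, div_mul_cancel₀ _ hpos.ne'⟩⟩
    rw [Complex.ofReal_div, eq_div_iff (by exact_mod_cast hpos.ne'), ← hsum]
    push_cast
    rfl

theorem neg_norm_mul_le_re {m : ℕ} (M : Matrix (Fin m) (Fin m) ℂ) (y : Fin m → ℂ) :
    -(‖M‖ * ∑ k, ‖y k‖ ^ 2) ≤ (star y ⬝ᵥ (M *ᵥ y)).re := by
  have h1 : star y ⬝ᵥ (M *ᵥ y) = inner ℂ (WithLp.toLp 2 y) (WithLp.toLp 2 (M *ᵥ y)) := by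
    rw [EuclideanSpace.inner_toLp_toLp, dotProduct_comm]
  have h2 := norm_inner_le_norm (𝕜 := ℂ) (WithLp.toLp 2 y) (WithLp.toLp 2 (M *ᵥ y))
  have h3 := norm_toLp_mulVec_le M y
  have h4 : ‖WithLp.toLp 2 y‖ ^ 2 = ∑ k, ‖y k‖ ^ 2 := by
    rw [EuclideanSpace.norm_sq_eq]
  have h5 := neg_le_of_abs_le (Complex.abs_re_le_norm (star y ⬝ᵥ (M *ᵥ y)))
  rw [h1] at h5 ⊢
  rw [← h4]
  nlinarith [norm_nonneg (WithLp.toLp 2 y)]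

/-- The lowest `r` columns of an eigenbasis give the Gram matrix `diag(1, …, 1, 0, …, 0)`. -/
theorem re_star_gram {n l r : ℕ} {X : Matrix (Fin n) (Fin l) ℂ} (hX : Xᴴ * X = 1) (hrl : r ≤ l)
    (y : Fin l → ℂ) :
    (star y ⬝ᵥ ((Xᴴ * (X.submatrix id (Fin.castLE hrl) * (X.submatrix id (Fin.castLE hrl))ᴴ) * X)
      *ᵥ y)).re = ∑ k : Fin l, if (k : ℕ) < r then ‖y k‖ ^ 2 else 0 := by
  set Y := X.submatrix id (Fin.castLE hrl) with hY
  have h1 : Yᴴ * X = (1 : Matrix (Fin l) (Fin l) ℂ).submatrix (Fin.castLE hrl) id := by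
    rw [← hX, hY, conjTranspose_submatrix]
    exact (submatrix_mul Xᴴ X (Fin.castLE hrl) id id Function.bijective_id).symm
  have h2 : (Yᴴ * X) *ᵥ y = fun k => y (Fin.castLE hrl k) := by
    ext k
    rw [h1]
    simp [mulVec, dotProduct, Matrix.one_apply]
  have h3 : Xᴴ * (Y * Yᴴ) * X = (Yᴴ * X)ᴴ * (Yᴴ * X) := by
    rw [conjTranspose_mul, conjTranspose_conjTranspose]
    simp only [Matrix.mul_assoc]
  rw [h3, ← mulVec_mulVec, dotProduct_mulVec, ← star_mulVec, h2]
  have := sum_fin_eq_sum_ite hrl (fun k => if h : k < l then ‖y ⟨k, h⟩‖ ^ 2 else 0)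
  simp only [Fin.is_lt, dite_true, Fin.eta] at this
  rw [← this, dotProduct, Complex.re_sum]
  refine Finset.sum_congr rfl fun k _ => ?_
  rw [dif_pos (k.2.trans_le hrl)]
  simp [Complex.sq_norm, Complex.normSq_apply, Fin.castLE]

/-- If the Ritz projector is close to the spectral projector, then `β` is bounded below by almost
the distance of the two smallest eigenvalues. -/
theorem le_beta {n l r : ℕ} {B : Matrix (Fin n) (Fin n) ℂ} (hB : B.IsHermitian)
    {X : Matrix (Fin n) (Fin l) ℂ} (hX : IsLowestEigenbasis B X) (hr : 1 ≤ r) (hrl : r ≤ l)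
    (hl : l < n) (U : Matrix (Fin n) (Fin r) ℂ) :
    eig B 2 - eig B 1 - (eig B (l + 1) - eig B 1) * (‖X‖ * ‖U * Uᴴ -
      X.submatrix id (Fin.castLE hrl) * (X.submatrix id (Fin.castLE hrl))ᴴ‖ * ‖X‖) ≤
    beta B X U := by
  set Y := X.submatrix id (Fin.castLE hrl) with hY
  set F := Xᴴ * (U * Uᴴ - Y * Yᴴ) * X with hF
  have hFn : ‖F‖ ≤ ‖X‖ * ‖U * Uᴴ - Y * Yᴴ‖ * ‖X‖ := by
    refine (frobenius_norm_mul _ _).trans ?_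
    gcongr
    refine (frobenius_norm_mul _ _).trans ?_
    rw [frobenius_norm_conjTranspose]
  set γ : Fin l → ℝ := fun k => eig B (l + 1) - eig B (k + 1) with hγd
  set δ : Fin l → ℝ := fun k => eig B (k + 1) - eig B 1 with hδd
  have hγ : ∀ k, 0 ≤ γ k := fun k =>
    sub_nonneg.2 (eig_le_eig hB (by omega) (by omega) (by omega))
  have hγ1 : ∀ k, γ k ≤ eig B (l + 1) - eig B 1 := fun k =>
    sub_le_sub_left (eig_le_eig hB le_rfl (by omega) (by omega)) _
  set Γ := eig B (l + 1) - eig B 1 with hΓ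
  have hΓ2 : eig B 2 - eig B 1 ≤ Γ := sub_le_sub_right (eig_le_eig hB (by omega) (by omega) hl) _
  have hΓ0 : 0 ≤ Γ := sub_nonneg.2 (eig_le_eig hB le_rfl (by omega) hl)
  have hK : (diagonal fun k : Fin l => ((eig B (k + 1) - eig B 1 : ℝ) : ℂ)) -
      Xᴴ * U * Uᴴ * X *
        diagonal (fun k : Fin l => ((eig B (k + 1) - eig B (l + 1) : ℝ) : ℂ)) =
      diagonal (fun k => (δ k : ℂ)) + (Xᴴ * (U * Uᴴ) * X) * diagonal fun k => (γ k : ℂ) := by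
    have : (diagonal (fun k : Fin l => ((eig B (k + 1) - eig B (l + 1) : ℝ) : ℂ))) =
        -diagonal fun k => (γ k : ℂ) := by
      rw [diagonal_neg]
      congr 1
      ext k
      simp [hγd]
    rw [this, Matrix.mul_neg, sub_neg_eq_add]
    simp only [Matrix.mul_assoc]
    rfl
  have hG : (Xᴴ * (U * Uᴴ) * X).IsHermitian :=
    isHermitian_conjTranspose_mul_mul X (isHermitian_mul_conjTranspose_self U)
  rw [beta, hK, minRealEigenvalue]
  have : Nonempty (Fin l) := ⟨⟨0, by omega⟩⟩
  -- a real eigenvalue exists, so the infimum is not a junk value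
  refine le_csInf ?_ ?_
  · obtain ⟨b, hb⟩ := spectrum.nonempty_of_isAlgClosed_of_finiteDimensional ℂ
      (diagonal (fun k => (δ k : ℂ)) + (Xᴴ * (U * Uᴴ) * X) * diagonal fun k => (γ k : ℂ))
    obtain ⟨β, rfl, -⟩ := eigenvalue_of_diagonal_add hγ hG hb
    exact ⟨β, hb⟩
  · intro b hb
    obtain ⟨β, hβ, h⟩ := eigenvalue_of_diagonal_add hγ hG hb
    obtain rfl : b = β := Complex.ofReal_injective hβ
    have hlow : eig B 2 - eig B 1 - Γ * (‖X‖ * ‖U * Uᴴ - Y * Yᴴ‖ * ‖X‖) ≤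
        eig B 2 - eig B 1 - Γ * ‖F‖ := by gcongr
    refine hlow.trans ?_
    rcases h with ⟨k, hk0, hk⟩ | ⟨x, hm, hx⟩
    · have : δ k = Γ := by simp only [hδd, hΓ]; simp only [hγd] at hk0; linarith
      rw [hk, this]
      nlinarith [mul_nonneg hΓ0 (norm_nonneg F)]
    · refine le_of_mul_le_mul_right ?_ hm
      rw [hx]
      set y : Fin l → ℂ := fun k => γ k * x k with hy
      have hyn : ∀ k, ‖y k‖ ^ 2 = γ k * (γ k * ‖x k‖ ^ 2) := by
        intro k
        rw [hy]
        simp only [norm_mul, Complex.norm_real, Real.norm_eq_abs, mul_pow, sq_abs]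
        ring
      have hsplit : (star y ⬝ᵥ ((Xᴴ * (U * Uᴴ) * X) *ᵥ y)).re =
          (∑ k : Fin l, if (k : ℕ) < r then ‖y k‖ ^ 2 else 0) + (star y ⬝ᵥ (F *ᵥ y)).re := by
        rw [← re_star_gram hX.1 hrl y, ← Complex.add_re, ← dotProduct_add, ← add_mulVec,
          hF, ← Matrix.add_mul, ← Matrix.mul_add, ← hY, add_sub_cancel]
      rw [hsplit]
      have hFy := neg_norm_mul_le_re F y
      -- for `k < r` the two contributions add up to `δ k + γ k = Γ`; for `k ≥ r` already
      -- `δ k` is at least the gap, since then `k ≥ 1`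
      have hterm : (eig B 2 - eig B 1 - Γ * ‖F‖) * ∑ k, γ k * ‖x k‖ ^ 2 ≤
          ∑ k, γ k * δ k * ‖x k‖ ^ 2 + ((∑ k : Fin l, if (k : ℕ) < r then ‖y k‖ ^ 2 else 0) -
            ‖F‖ * ∑ k, ‖y k‖ ^ 2) := by
        rw [Finset.mul_sum, Finset.mul_sum, ← Finset.sum_sub_distrib, ← Finset.sum_add_distrib]
        refine Finset.sum_le_sum fun k _ => ?_
        have hgx : 0 ≤ γ k * ‖x k‖ ^ 2 := mul_nonneg (hγ k) (by positivity)
        have hFk : ‖F‖ * ‖y k‖ ^ 2 ≤ Γ * ‖F‖ * (γ k * ‖x k‖ ^ 2) := by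
          rw [hyn]
          calc ‖F‖ * (γ k * (γ k * ‖x k‖ ^ 2)) ≤ ‖F‖ * (Γ * (γ k * ‖x k‖ ^ 2)) := by
                gcongr; exact hγ1 k
            _ = _ := by ring
        split_ifs with hk
        · have : δ k + γ k = Γ := by simp only [hδd, hγd, hΓ]; ring
          rw [hyn] at hFk ⊢
          have h1 := mul_le_mul_of_nonneg_right (this ▸ hΓ2) hgx
          linarith
        · have : eig B 2 - eig B 1 ≤ δ k :=
            sub_le_sub_right (eig_le_eig hB (by omega) (by omega) (by omega)) _
          have h1 := mul_le_mul_of_nonneg_right this hgx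
          linarith
      linarith

end Residual

/-! ### The linear program near a sample -/

section LinearProgram

open Filter Topology

theorem affine_isHermitian {N Q : ℕ} {a : Fin Q → Matrix (Fin N) (Fin N) ℂ}
    (ha : ∀ q, (a q).IsHermitian) (c : Fin Q → ℝ) : (affine a c).IsHermitian := by
  rw [IsHermitian, affine, conjTranspose_sum]
  refine Finset.sum_congr rfl fun q _ => ?_
  rw [conjTranspose_smul, (ha q).eq]
  simp

theorem trace_affine_mul {N Q : ℕ} (a : Fin Q → Matrix (Fin N) (Fin N) ℂ) (c : Fin Q → ℝ)
    (M : Matrix (Fin N) (Fin N) ℂ) :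
    (affine a c * M).trace.re = c ⬝ᵥ fun q => (a q * M).trace.re := by
  simp [affine, Finset.sum_mul, trace_sum, dotProduct]

/-- The Rayleigh quotients of a unit vector form a feasible point. -/
theorem rayleigh_mem_polytope {N Q J : ℕ} {a : Fin Q → Matrix (Fin N) (Fin N) ℂ}
    (ha : ∀ q, (a q).IsHermitian) (hN : 1 ≤ N) (t : Fin J → Fin Q → ℝ)
    {v : Matrix (Fin N) (Fin 1) ℂ} (hv : vᴴ * v = 1) :
    (fun q => (a q * (v * vᴴ)).trace.re) ∈ polytope a t := by
  refine ⟨fun q => ⟨eigMin_le_rayleigh (ha q) hN hv, rayleigh_le_eigMax (ha q) hv⟩, fun j => ?_⟩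
  rw [← trace_affine_mul]
  exact eigMin_le_rayleigh (affine_isHermitian ha _) hN hv

theorem eq_of_normal_dotProduct_eq {Q : ℕ} {b : Fin Q → Fin Q → ℝ}
    (hb : LinearIndependent ℝ b) {y z : Fin Q → ℝ} (h : ∀ k, b k ⬝ᵥ y = b k ⬝ᵥ z) : y = z := by
  have hu : IsUnit (Matrix.of b) := linearIndependent_rows_iff_isUnit.1 hb
  exact mulVec_injective_iff_isUnit.2 hu (funext h)

/-- A feasible point with `Q` linearly independent active constraints is a vertex. -/
theorem mem_extremePoints_of_active {N Q J : ℕ} {a : Fin Q → Matrix (Fin N) (Fin N) ℂ}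
    {t : Fin J → Fin Q → ℝ} {s : Fin Q → Constraint Q J} {y : Fin Q → ℝ} (hy : y ∈ polytope a t)
    (hact : ∀ k, normal t (s k) ⬝ᵥ y = rhs a t (s k))
    (hli : LinearIndependent ℝ fun k => normal t (s k)) :
    y ∈ Set.extremePoints ℝ (polytope a t) := by
  rw [mem_extremePoints]
  have key : ∀ y₁ ∈ polytope a t, ∀ y₂ ∈ polytope a t, y ∈ openSegment ℝ y₁ y₂ → y₁ = y := by
    rintro y₁ h₁ y₂ h₂ ⟨α, β, hα, hβ, hαβ, hc⟩
    refine eq_of_normal_dotProduct_eq hli fun k => ?_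
    have e := hact k
    rw [← hc, dotProduct_add, dotProduct_smul, dotProduct_smul, smul_eq_mul, smul_eq_mul] at e
    have g₁ := (mem_polytope_iff a t y₁).1 h₁ (s k)
    have g₂ := (mem_polytope_iff a t y₂).1 h₂ (s k)
    rw [hact k]
    refine le_antisymm ?_ g₁
    obtain rfl : β = 1 - α := by linarith
    nlinarith [mul_le_mul_of_nonneg_left g₂ hβ.le]
  refine ⟨hy, fun y₁ h₁ y₂ h₂ h => ⟨key y₁ h₁ y₂ h₂ h, key y₂ h₂ y₁ h₁ ?_⟩⟩
  rwa [openSegment_symm]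

/-- If the sample constraint `i` can be attained, then every optimal active set for the objective
`θ(μ_i)` contains that constraint: it is active at the optimal vertex, and by simplicity the active
set lists all active constraints there. -/
theorem exists_eq_sample_of_isOptimalActiveSet {N Q J : ℕ}
    {a : Fin Q → Matrix (Fin N) (Fin N) ℂ} {t : Fin J → Fin Q → ℝ} (hpoly : IsSimplePolytope a t)
    {i : Fin J} {z : Fin Q → ℝ} (hz : z ∈ polytope a t)
    (hzi : t i ⬝ᵥ z = eigMin (affine a (t i))) {s : Fin Q → Constraint Q J}
    (hs : IsOptimalActiveSet a t (t i) s) : ∃ k, s k = .inr (.inr i) := by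
  obtain ⟨y, hy, hmin, hact, hli⟩ := hs
  have hi : normal t (.inr (.inr i)) ⬝ᵥ y = rhs a t (.inr (.inr i)) :=
    le_antisymm ((hmin z hz).trans hzi.le) (hy.2 i)
  have hcard := hpoly y (mem_extremePoints_of_active hy hact hli)
  have hinj : Function.Injective s := fun k k' h => hli.injective (by simp only [h])
  have hsub : Set.range s ⊆ {k | normal t k ⬝ᵥ y = rhs a t k} := by
    rintro _ ⟨k, rfl⟩
    exact hact k
  have heq : Set.range s = {k | normal t k ⬝ᵥ y = rhs a t k} := by
    refine Set.eq_of_subset_of_ncard_le hsub ?_ (Set.toFinite _)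
    rw [hcard, ← Set.image_univ, Set.ncard_image_of_injective _ hinj, Set.ncard_univ,
      Nat.card_eq_fintype_card, Fintype.card_fin]
  have : (.inr (.inr i) : Constraint Q J) ∈ Set.range s := by rw [heq]; exact hi
  exact this

/-- An active set that is optimal for objectives arbitrarily close to `c₀` is optimal for `c₀`. -/
theorem isOptimalActiveSet_of_frequently {N Q J : ℕ} {E : Type*} {F : Filter E}
    {a : Fin Q → Matrix (Fin N) (Fin N) ℂ} {t : Fin J → Fin Q → ℝ} {c : E → Fin Q → ℝ}
    {c₀ : Fin Q → ℝ} (hc : Tendsto c F (𝓝 c₀)) {s : Fin Q → Constraint Q J}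
    (hs : ∃ᶠ μ in F, IsOptimalActiveSet a t (c μ) s) : IsOptimalActiveSet a t c₀ s := by
  obtain ⟨_, y, hy, -, hact, hli⟩ := hs.exists
  refine ⟨y, hy, fun z hz => ?_, hact, hli⟩
  have hlim : ∀ w : Fin Q → ℝ, Tendsto (fun μ => c μ ⬝ᵥ w) F (𝓝 (c₀ ⬝ᵥ w)) := fun w =>
    ((continuous_id.dotProduct continuous_const).tendsto c₀).comp hc
  have hfr : ∃ᶠ μ in F, 0 ≤ c μ ⬝ᵥ z - c μ ⬝ᵥ y := by
    refine hs.mono fun μ => ?_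
    rintro ⟨y', -, hmin', hact', -⟩
    rw [eq_of_normal_dotProduct_eq hli fun k => (hact k).trans (hact' k).symm]
    exact sub_nonneg.2 (hmin' z hz)
  exact sub_nonneg.1 (ge_of_tendsto_of_frequently ((hlim z).sub (hlim y)) hfr)

/-- Near `c₀`, the chosen active sets are optimal for `c₀`, as there are finitely many of them. -/
theorem eventually_isOptimalActiveSet {N Q J : ℕ} {E : Type*} {F : Filter E}
    {a : Fin Q → Matrix (Fin N) (Fin N) ℂ} {t : Fin J → Fin Q → ℝ} {c : E → Fin Q → ℝ}
    {c₀ : Fin Q → ℝ} (hc : Tendsto c F (𝓝 c₀)) {s : E → Fin Q → Constraint Q J}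
    (hs : ∀ᶠ μ in F, IsOptimalActiveSet a t (c μ) (s μ)) :
    ∀ᶠ μ in F, IsOptimalActiveSet a t c₀ (s μ) := by
  have h : ∀ᶠ μ in F, ∀ s₀, s μ = s₀ → IsOptimalActiveSet a t c₀ s₀ := by
    rw [eventually_all]
    intro s₀
    by_cases h0 : IsOptimalActiveSet a t c₀ s₀
    · exact Eventually.of_forall fun _ _ => h0
    · have := mt (isOptimalActiveSet_of_frequently hc) h0
      rw [not_frequently] at this
      filter_upwards [this, hs] with μ h1 h2 h3
      exact absurd (h3 ▸ h2) h1
  exact h.mono fun μ h => h _ rfl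

/-- If the updated right-hand sides stay bounded and the one of constraint `i` stays above
`λ_i + 2 δ`, where `t i` is the limit of the objectives, then `η` eventually stays above `λ_i + δ`. -/
theorem eventually_le_eta {N Q J l r : ℕ} {E : Type*} {F : Filter E}
    {a : Fin Q → Matrix (Fin N) (Fin N) ℂ} {t : Fin J → Fin Q → ℝ} (hpoly : IsSimplePolytope a t)
    {i : Fin J} {z : Fin Q → ℝ} (hz : z ∈ polytope a t)
    (hzi : t i ⬝ᵥ z = eigMin (affine a (t i))) {c : E → Fin Q → ℝ} (hc : Tendsto c F (𝓝 (t i)))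
    {s : E → Fin Q → Constraint Q J} (hs : ∀ᶠ μ in F, IsOptimalActiveSet a t (c μ) (s μ))
    {X : Fin J → Matrix (Fin N) (Fin l) ℂ} {U : E → Matrix (Fin N) (Fin r) ℂ} {K δ : ℝ}
    (hδ : 0 < δ) (hK : ∀ᶠ μ in F, ∀ k, |updatedRhs a t X (U μ) k| ≤ K)
    (hβ : ∀ᶠ μ in F, 2 * δ ≤ beta (affine a (t i)) (X i) (U μ)) :
    ∀ᶠ μ in F, eigMin (affine a (t i)) + δ ≤ eta a t X (U μ) (s μ) (c μ) := by
  have h : ∀ᶠ μ in F, ∀ s₀, IsOptimalActiveSet a t (t i) s₀ →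
      eigMin (affine a (t i)) + δ ≤ eta a t X (U μ) s₀ (c μ) := by
    rw [eventually_all]
    intro s₀
    by_cases h0 : IsOptimalActiveSet a t (t i) s₀
    swap
    · exact Eventually.of_forall fun _ h => absurd h h0
    obtain ⟨k₀, hk₀⟩ := exists_eq_sample_of_isOptimalActiveSet hpoly hz hzi h0
    obtain ⟨-, -, -, -, hli⟩ := h0
    set Θ : Matrix (Fin Q) (Fin Q) ℝ := Matrix.of fun k => normal t (s₀ k) with hΘ
    have hu : IsUnit Θ.det := (isUnit_iff_isUnit_det Θ).1 (linearIndependent_rows_iff_isUnit.1 hli)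
    -- `θ(μ_i)` is the row `k₀` of `Θ`, so that `θ(μ)ᵀ Θ⁻¹` tends to a unit vector
    have hrow : t i ᵥ* Θ⁻¹ = Pi.single k₀ 1 := by
      have h1 : t i = Pi.single k₀ 1 ᵥ* Θ := by
        rw [single_one_vecMul]
        change t i = normal t (s₀ k₀)
        rw [hk₀]
        rfl
      rw [h1, vecMul_vecMul, mul_nonsing_inv _ hu, vecMul_one]
    have hlim : Tendsto (fun μ => c μ ᵥ* Θ⁻¹) F (𝓝 (Pi.single k₀ 1)) := by
      rw [← hrow]
      exact ((continuous_id.matrix_vecMul continuous_const).tendsto (t i)).comp hc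
    have hlim2 : Tendsto (fun μ => |K| * ∑ k, |(c μ ᵥ* Θ⁻¹) k - (Pi.single k₀ 1 : Fin Q → ℝ) k|) F
        (𝓝 0) := by
      have : Tendsto (fun μ => |K| * ∑ k, |(c μ ᵥ* Θ⁻¹) k - (Pi.single k₀ 1 : Fin Q → ℝ) k|) F
          (𝓝 (|K| * ∑ k, |(Pi.single k₀ 1 : Fin Q → ℝ) k - (Pi.single k₀ 1 : Fin Q → ℝ) k|)) := by
        refine Tendsto.const_mul _ (tendsto_finsetSum _ fun k _ => ?_)
        exact ((tendsto_pi_nhds.1 hlim k).sub_const _).abs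
      simpa using this
    filter_upwards [hlim2.eventually (gt_mem_nhds hδ), hK, hβ] with μ h1 h2 h3 _
    set ψ : Fin Q → ℝ := fun k => updatedRhs a t X (U μ) (s₀ k) with hψ
    have hη : eta a t X (U μ) s₀ (c μ) =
        ψ k₀ + ∑ k, ((c μ ᵥ* Θ⁻¹) k - (Pi.single k₀ 1 : Fin Q → ℝ) k) * ψ k := by
      rw [eta, dotProduct_mulVec, dotProduct]
      simp only [sub_mul, Finset.sum_sub_distrib]
      rw [show ∑ k, (Pi.single k₀ 1 : Fin Q → ℝ) k * ψ k = ψ k₀ from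
        single_one_dotProduct k₀ ψ]
      ring
    have hψ0 : eigMin (affine a (t i)) + 2 * δ ≤ ψ k₀ := by
      rw [hψ]
      simp only [hk₀, updatedRhs, rhs]
      linarith
    have hrem : |∑ k, ((c μ ᵥ* Θ⁻¹) k - (Pi.single k₀ 1 : Fin Q → ℝ) k) * ψ k| ≤
        |K| * ∑ k, |(c μ ᵥ* Θ⁻¹) k - (Pi.single k₀ 1 : Fin Q → ℝ) k| := by
      refine (Finset.abs_sum_le_sum_abs _ _).trans ?_
      rw [Finset.mul_sum]
      refine Finset.sum_le_sum fun k _ => ?_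
      rw [abs_mul, mul_comm]
      exact mul_le_mul_of_nonneg_right ((h2 (s₀ k)).trans (le_abs_self K)) (abs_nonneg _)
    rw [hη]
    linarith [neg_le_of_abs_le hrem]
  filter_upwards [h, eventually_isOptimalActiveSet hc hs] with μ h1 h2
  exact h1 _ h2

end LinearProgram

/-! ### The Ritz subspace near a sample -/

section Ritz

attribute [local instance] Matrix.frobeniusNormedAddCommGroup Matrix.frobeniusNormedSpace

open Filter Topology Asymptotics

theorem le_of_conjTranspose_mul_self_eq_one {n r : ℕ} {Y : Matrix (Fin n) (Fin r) ℂ}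
    (hY : Yᴴ * Y = 1) : r ≤ n := by
  have h := rank_mul_le_right Yᴴ Y
  rw [hY, rank_one, Fintype.card_fin] at h
  simpa using h.trans Y.rank_le_height

/-- The sampled eigenvectors are fixed by the projector onto the subspace. -/
theorem IsOrthonormalBasisOfSamples.mul_mul_eq {N J l d : ℕ}
    {X : Fin J → Matrix (Fin N) (Fin l) ℂ} {V : Matrix (Fin N) (Fin d) ℂ}
    (hV : IsOrthonormalBasisOfSamples X V) (j : Fin J) : V * (Vᴴ * X j) = X j := by
  have hcol : ∀ k, (X j).col k ∈ Submodule.span ℂ (Set.range V.col) := by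
    intro k
    rw [hV.2]
    exact Submodule.subset_span (Set.mem_iUnion.2 ⟨j, k, rfl⟩)
  ext p k
  obtain ⟨x, hx⟩ : ∃ x, V *ᵥ x = (X j).col k := by
    have := hcol k
    rw [← range_mulVecLin] at this
    exact this
  have h : (V * (Vᴴ * X j)).col k = (X j).col k := by
    have : (V * (Vᴴ * X j)).col k = V *ᵥ (Vᴴ *ᵥ (X j).col k) := rfl
    rw [this, ← hx, mulVec_mulVec x Vᴴ V, hV.1, one_mulVec]
  exact congrFun h p

theorem trace_compression {N d r : ℕ} (A : Matrix (Fin N) (Fin N) ℂ) (V : Matrix (Fin N) (Fin d) ℂ)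
    (w : Matrix (Fin d) (Fin r) ℂ) :
    ((Vᴴ * A * V) * (w * wᴴ)).trace = (A * ((V * w) * (V * w)ᴴ)).trace := by
  rw [Matrix.mul_assoc, Matrix.mul_assoc, trace_mul_comm, conjTranspose_mul]
  simp only [Matrix.mul_assoc]

theorem conjTranspose_mul_self_of_compression {N d r : ℕ} {V : Matrix (Fin N) (Fin d) ℂ}
    (hV : Vᴴ * V = 1) {w : Matrix (Fin d) (Fin r) ℂ} (hw : wᴴ * w = 1) :
    (V * w)ᴴ * (V * w) = 1 := by
  rw [conjTranspose_mul, Matrix.mul_assoc, ← Matrix.mul_assoc Vᴴ, hV, Matrix.one_mul, hw]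

/-- By the Ky Fan inequality, the Rayleigh trace of the Ritz frame is at most that of any frame in the subspace. -/
theorem trace_ritz_le {N d r : ℕ} {A : Matrix (Fin N) (Fin N) ℂ} (hA : A.IsHermitian)
    {V : Matrix (Fin N) (Fin d) ℂ} {W : Matrix (Fin d) (Fin r) ℂ}
    (hW : IsLowestEigenbasis (Vᴴ * A * V) W) {Y : Matrix (Fin N) (Fin r) ℂ} (hY : Yᴴ * Y = 1)
    (hVY : V * (Vᴴ * Y) = Y) :
    (A * ((V * W) * (V * W)ᴴ)).trace.re ≤ (A * (Y * Yᴴ)).trace.re := by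
  have hY' : (Vᴴ * Y)ᴴ * (Vᴴ * Y) = 1 := by
    rw [conjTranspose_mul, conjTranspose_conjTranspose, Matrix.mul_assoc, hVY, hY]
  have h := sum_eig_le_trace (isHermitian_conjTranspose_mul_mul V hA) hY'
    (le_of_conjTranspose_mul_self_eq_one hY')
  rw [trace_compression, hVY] at h
  rwa [← trace_compression, hW.trace_re]

theorem eigMin_eq_rayleigh {n : ℕ} {B : Matrix (Fin n) (Fin n) ℂ} {v : Matrix (Fin n) (Fin 1) ℂ}
    (hv : IsLowestEigenbasis B v) : (B * (v * vᴴ)).trace.re = eigMin B := by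
  rw [hv.trace_re]
  simp [eigMin]

theorem eigMin_le_ritz {N d : ℕ} {A : Matrix (Fin N) (Fin N) ℂ} (hA : A.IsHermitian) (hd : 1 ≤ d)
    {V : Matrix (Fin N) (Fin d) ℂ} (hV : Vᴴ * V = 1) : eigMin A ≤ eigMin (Vᴴ * A * V) := by
  obtain ⟨T, hT⟩ := exists_isLowestEigenbasis (isHermitian_conjTranspose_mul_mul V hA)
  rw [← eigMin_eq_rayleigh (hT.castLE hd), trace_compression]
  exact eigMin_le_rayleigh hA (hd.trans (le_of_conjTranspose_mul_self_eq_one hV))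
    (conjTranspose_mul_self_of_compression hV (hT.castLE hd).1)

theorem ritz_le_rayleigh {N d : ℕ} {A : Matrix (Fin N) (Fin N) ℂ} (hA : A.IsHermitian) (hd : 1 ≤ d)
    {V : Matrix (Fin N) (Fin d) ℂ} {v : Matrix (Fin N) (Fin 1) ℂ} (hv : vᴴ * v = 1)
    (hVv : V * (Vᴴ * v) = v) : eigMin (Vᴴ * A * V) ≤ (A * (v * vᴴ)).trace.re := by
  obtain ⟨T, hT⟩ := exists_isLowestEigenbasis (isHermitian_conjTranspose_mul_mul V hA)
  rw [← eigMin_eq_rayleigh (hT.castLE hd), trace_compression]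
  exact trace_ritz_le hA (hT.castLE hd) hv hVv

theorem isBigO_norm_affine_sub {N Q P : ℕ} (a : Fin Q → Matrix (Fin N) (Fin N) ℂ)
    {θ : EuclideanSpace ℝ (Fin P) → Fin Q → ℝ} {x₀ : EuclideanSpace ℝ (Fin P)}
    (hθ : ∀ q, DifferentiableAt ℝ (fun μ => θ μ q) x₀) :
    (fun μ => ‖affine a (θ μ) - affine a (θ x₀)‖) =O[𝓝 x₀] fun μ => μ - x₀ := by
  have h1 : (fun μ => ∑ q, |θ μ q - θ x₀ q| * ‖a q‖) =O[𝓝 x₀] fun μ => μ - x₀ := by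
    refine IsBigO.fun_sum fun q _ => ?_
    have h2 := ((hθ q).isBigO_sub).norm_left.const_mul_left ‖a q‖
    refine h2.congr_left fun μ => ?_
    rw [Real.norm_eq_abs, mul_comm]
  refine IsBigO.trans (IsBigO.of_bound 1 (Eventually.of_forall fun μ => ?_)) h1
  rw [one_mul, norm_norm, Real.norm_of_nonneg (by positivity), affine, affine,
    ← Finset.sum_sub_distrib]
  refine (norm_sum_le _ _).trans (Finset.sum_le_sum fun q _ => ?_)
  rw [← sub_smul, norm_smul, ← Complex.ofReal_sub, Complex.norm_real, Real.norm_eq_abs]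

/-- A function that agrees with a differentiable function up to a quadratic error has the same value
and the same derivative. -/
theorem eq_and_hasFDerivAt_of_sq_error {E : Type*} [NormedAddCommGroup E] [NormedSpace ℝ E]
    {f g e : E → ℝ} {x₀ : E} {f' : E →L[ℝ] ℝ} (hf : HasFDerivAt f f' x₀)
    (he : e =O[𝓝 x₀] fun x => x - x₀) {C : ℝ} (h : ∀ᶠ x in 𝓝 x₀, |g x - f x| ≤ C * e x ^ 2) :
    g x₀ = f x₀ ∧ HasFDerivAt g f' x₀ := by
  have h1 : (fun x => g x - f x) =O[𝓝 x₀] fun x => ‖x - x₀‖ ^ 2 := by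
    have h2 : (fun x => g x - f x) =O[𝓝 x₀] fun x => e x ^ 2 := by
      refine IsBigO.of_bound C (h.mono fun x hx => ?_)
      rwa [Real.norm_eq_abs, Real.norm_of_nonneg (sq_nonneg _)]
    exact h2.trans (he.norm_right.pow 2)
  have h3 : HasFDerivAt (fun x => g x - f x) (0 : E →L[ℝ] ℝ) x₀ := h1.hasFDerivAt one_lt_two
  refine ⟨?_, ?_⟩
  · have := h1.eq_zero_of_norm_pow (n := 2) (by norm_num)
    exact sub_eq_zero.1 this
  · have := h3.add hf
    rw [zero_add] at this
    exact this.congr_of_eventuallyEq (Eventually.of_forall fun x => by simp)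

/-- The correction term subtracted in the subspace lower bound is at most `2 ρ² / |x - y|`. -/
theorem abs_min_sub_correction_sub_le {x y f ρ R g b : ℝ} (hg : 0 < g) (hgap : x + g ≤ y)
    (hρ0 : 0 ≤ ρ) (hρ : ρ ≤ R) (hxf : x ≤ f) (hfx : f - x ≤ b) :
    |min x y - 2 * ρ ^ 2 / (|x - y| + √(|x - y| ^ 2 + 4 * ρ ^ 2)) - f| ≤ b + 2 * R ^ 2 / g := by
  have h1 : g ≤ |x - y| + √(|x - y| ^ 2 + 4 * ρ ^ 2) := by
    have := Real.sqrt_nonneg (|x - y| ^ 2 + 4 * ρ ^ 2)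
    have := neg_le_abs (x - y)
    linarith
  have h2 : 2 * ρ ^ 2 / (|x - y| + √(|x - y| ^ 2 + 4 * ρ ^ 2)) ≤ 2 * R ^ 2 / g := by gcongr
  have h3 : 0 ≤ 2 * ρ ^ 2 / (|x - y| + √(|x - y| ^ 2 + 4 * ρ ^ 2)) := by positivity
  rw [min_eq_left (by linarith), abs_le]
  constructor <;> linarith

end Ritz

/-! ### The subspace lower bound near a sample -/

section LowerBound

attribute [local instance] Matrix.frobeniusNormedAddCommGroup Matrix.frobeniusNormedSpace

open Filter Topology Asymptotics

theorem exists_abs_updatedRhs_le {N Q J l r : ℕ} (a : Fin Q → Matrix (Fin N) (Fin N) ℂ)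
    (t : Fin J → Fin Q → ℝ) (X : Fin J → Matrix (Fin N) (Fin l) ℂ) :
    ∃ K : ℝ, ∀ U : Matrix (Fin N) (Fin r) ℂ, Uᴴ * U = 1 → ∀ k, |updatedRhs a t X U k| ≤ K := by
  choose c hc0 hc using fun j => exists_abs_beta_le (r := r) (affine a (t j)) (X j)
  have h1 : ∀ k, |rhs a t k| ≤ ∑ k, |rhs a t k| := fun k =>
    Finset.single_le_sum (f := fun k => |rhs a t k|) (fun _ _ => abs_nonneg _) (Finset.mem_univ k)
  have h2 : ∀ j, c j ≤ ∑ j, c j := fun j =>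
    Finset.single_le_sum (fun j _ => hc0 j) (Finset.mem_univ j)
  have h3 : 0 ≤ ∑ j, c j := Finset.sum_nonneg fun j _ => hc0 j
  refine ⟨∑ k, |rhs a t k| + ∑ j, c j, fun U hU k => ?_⟩
  rcases k with q | q | j
  · exact (h1 (.inl q)).trans (le_add_of_nonneg_right h3)
  · exact (h1 (.inr (.inl q))).trans (le_add_of_nonneg_right h3)
  · exact (abs_add_le _ _).trans (add_le_add (h1 _) ((hc j U hU).trans (h2 j)))

/-- Near `μ_i` both `λ_min(A(μ))` and the subspace lower bound agree with the Rayleigh quotient of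
the lowest eigenvector of `A(μ_i)` up to an error of second order. -/
theorem exists_sq_error {P N Q J l r d : ℕ} {D : Set (EuclideanSpace ℝ (Fin P))}
    {a : Fin Q → Matrix (Fin N) (Fin N) ℂ} (ha : ∀ q, (a q).IsHermitian)
    {θ : EuclideanSpace ℝ (Fin P) → Fin Q → ℝ} {sample : Fin J → EuclideanSpace ℝ (Fin P)}
    (hr : 1 ≤ r) (hrl : r ≤ l) (hlN : l < N) {X : Fin J → Matrix (Fin N) (Fin l) ℂ}
    (hX : ∀ j, IsLowestEigenbasis (affine a (θ (sample j))) (X j))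
    {V : Matrix (Fin N) (Fin d) ℂ} (hV : IsOrthonormalBasisOfSamples X V)
    {W : EuclideanSpace ℝ (Fin P) → Matrix (Fin d) (Fin r) ℂ}
    (hW : ∀ μ ∈ D, IsLowestEigenbasis (Vᴴ * affine a (θ μ) * V) (W μ))
    (hpoly : IsSimplePolytope a fun j => θ (sample j))
    {s : EuclideanSpace ℝ (Fin P) → Fin Q → Constraint Q J}
    (hs : ∀ μ ∈ D, IsOptimalActiveSet a (fun j => θ (sample j)) (θ μ) (s μ))
    {i : Fin J} (hi : sample i ∈ interior D)
    (hθ : ∀ q, DifferentiableAt ℝ (fun μ => θ μ q) (sample i))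
    (hsimple : IsSimpleEigenvalue (affine a (θ (sample i))) (eigMin (affine a (θ (sample i)))))
    (hgap : eig (affine a (θ (sample i))) r < eig (affine a (θ (sample i))) (r + 1)) :
    ∃ z : Fin Q → ℝ, θ (sample i) ⬝ᵥ z = eigMin (affine a (θ (sample i))) ∧ ∃ C : ℝ,
      (∀ᶠ μ in 𝓝 (sample i), |eigMin (affine a (θ μ)) - θ μ ⬝ᵥ z| ≤
        C * ‖affine a (θ μ) - affine a (θ (sample i))‖ ^ 2) ∧
      ∀ᶠ μ in 𝓝 (sample i), |lambdaSLB a θ sample X V W s μ - θ μ ⬝ᵥ z| ≤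
        C * ‖affine a (θ μ) - affine a (θ (sample i))‖ ^ 2 := by
  set B := affine a (θ (sample i)) with hBdef
  have hA : ∀ μ, (affine a (θ μ)).IsHermitian := fun μ => affine_isHermitian ha _
  have hB : B.IsHermitian := hA _
  have hl1 : 1 ≤ l := hr.trans hrl
  have hN1 : 1 ≤ N := by omega
  have hg : eig B 1 < eig B 2 := hsimple.eig_lt hB (by omega)
  -- the lowest eigenvector and the lowest `r` eigenvectors at `μ_i`; all of them lie in `range V`
  set v := (X i).submatrix id (Fin.castLE hl1) with hv
  set Y := (X i).submatrix id (Fin.castLE hrl) with hY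
  have hvl : IsLowestEigenbasis B v := (hX i).castLE hl1
  have hYl : IsLowestEigenbasis B Y := (hX i).castLE hrl
  have hfix := hV.mul_mul_eq i
  have hVv : V * (Vᴴ * v) = v := by
    conv_rhs => rw [hv, ← hfix]
    rfl
  have hVY : V * (Vᴴ * Y) = Y := by
    conv_rhs => rw [hY, ← hfix]
    rfl
  have hd : 1 ≤ d := by
    refine le_of_conjTranspose_mul_self_eq_one (Y := Vᴴ * v) ?_
    rw [conjTranspose_mul, conjTranspose_conjTranspose, Matrix.mul_assoc, hVv, hvl.1]
  obtain ⟨c₁, hc₁, h₁⟩ := exists_perturbation_bound hB hvl le_rfl (by omega) hg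
  obtain ⟨c₂, hc₂, h₂⟩ := exists_perturbation_bound hB hYl hr (by omega) hgap
  obtain ⟨c₃, hc₃, h₃⟩ := exists_rho_le hYl
  obtain ⟨K, hK⟩ := exists_abs_updatedRhs_le (r := r) a (fun j => θ (sample j)) X
  set z : Fin Q → ℝ := fun q => (a q * (v * vᴴ)).trace.re with hz
  have hfz : ∀ μ, θ μ ⬝ᵥ z = (affine a (θ μ) * (v * vᴴ)).trace.re := fun μ =>
    (trace_affine_mul a (θ μ) _).symm
  have hzi : θ (sample i) ⬝ᵥ z = eigMin B := by rw [hfz, eigMin_eq_rayleigh hvl]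
  have hzP : z ∈ polytope a fun j => θ (sample j) := rayleigh_mem_polytope ha hN1 _ hvl.1
  have hD : ∀ᶠ μ in 𝓝 (sample i), μ ∈ D := mem_interior_iff_mem_nhds.1 hi
  have hθc : Tendsto θ (𝓝 (sample i)) (𝓝 (θ (sample i))) :=
    tendsto_pi_nhds.2 fun q => (hθ q).continuousAt
  have he0 : Tendsto (fun μ => ‖affine a (θ μ) - B‖) (𝓝 (sample i)) (𝓝 0) := by
    refine (isBigO_norm_affine_sub a hθ).trans_tendsto ?_
    exact tendsto_sub_nhds_zero_iff.2 tendsto_id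
  have hf0 : Tendsto (fun μ => θ μ ⬝ᵥ z) (𝓝 (sample i)) (𝓝 (eigMin B)) := by
    rw [← hzi]
    exact ((continuous_id.dotProduct continuous_const).tendsto (θ (sample i))).comp hθc
  have hmin : ∀ μ, eigMin (affine a (θ μ)) ≤ θ μ ⬝ᵥ z ∧
      θ μ ⬝ᵥ z - eigMin (affine a (θ μ)) ≤ c₁ * ‖affine a (θ μ) - B‖ ^ 2 := by
    intro μ
    have hle : eigMin (affine a (θ μ)) ≤ θ μ ⬝ᵥ z := by
      rw [hfz]; exact eigMin_le_rayleigh (hA μ) hN1 hvl.1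
    obtain ⟨T, hT⟩ := exists_isLowestEigenbasis (hA μ)
    have hu := hT.castLE hN1
    refine ⟨hle, ?_⟩
    rw [hfz] at hle ⊢
    rw [← eigMin_eq_rayleigh hu] at hle ⊢
    exact (h₁ _ _ hu.1 hle).2
  have hU : ∀ μ ∈ D, (V * W μ)ᴴ * (V * W μ) = 1 := fun μ hμ =>
    conjTranspose_mul_self_of_compression hV.1 (hW μ hμ).1
  have hproj : ∀ μ ∈ D, ‖(V * W μ) * (V * W μ)ᴴ - Y * Yᴴ‖ ≤ c₂ * ‖affine a (θ μ) - B‖ :=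
    fun μ hμ => (h₂ _ _ (hU μ hμ) (trace_ritz_le (hA μ) (hW μ hμ) hYl.1 hVY)).1
  -- the shift of the constraint `i` and hence `η - λ_i` stay away from zero
  set δ := (eig B 2 - eig B 1) / 4 with hδ
  have hδ0 : 0 < δ := by linarith
  have hβ : ∀ᶠ μ in 𝓝 (sample i), 2 * δ ≤ beta B (X i) (V * W μ) := by
    have hlim : Tendsto (fun μ => (eig B (l + 1) - eig B 1) *
        (‖X i‖ * (c₂ * ‖affine a (θ μ) - B‖) * ‖X i‖)) (𝓝 (sample i)) (𝓝 0) := by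
      simpa using (((he0.const_mul c₂).const_mul ‖X i‖).mul_const ‖X i‖).const_mul
        (eig B (l + 1) - eig B 1)
    have hΓ : 0 ≤ eig B (l + 1) - eig B 1 := sub_nonneg.2 (eig_le_eig hB le_rfl (by omega) hlN)
    filter_upwards [hlim.eventually (gt_mem_nhds (show 0 < 2 * δ by linarith)), hD] with μ h hμ
    refine le_trans ?_ (le_beta hB (hX i) hr hrl hlN (V * W μ))
    have h4 : (eig B (l + 1) - eig B 1) *
        (‖X i‖ * ‖(V * W μ) * (V * W μ)ᴴ - Y * Yᴴ‖ * ‖X i‖) ≤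
        (eig B (l + 1) - eig B 1) * (‖X i‖ * (c₂ * ‖affine a (θ μ) - B‖) * ‖X i‖) := by
      gcongr
      exact hproj μ hμ
    linarith
  have hη := eventually_le_eta hpoly (i := i) hzP hzi hθc (s := s)
    (hD.mono fun μ hμ => hs μ hμ) (U := fun μ => V * W μ) hδ0
    (hD.mono fun μ hμ => hK _ (hU μ hμ)) hβ
  set R := c₃ * (1 + c₂) with hR
  refine ⟨z, hzi, c₁ + 2 * R ^ 2 / (δ / 2), Eventually.of_forall fun μ => ?_, ?_⟩
  · rw [abs_sub_comm, abs_of_nonneg (sub_nonneg.2 (hmin μ).1)]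
    refine (hmin μ).2.trans ?_
    gcongr
    exact le_add_of_nonneg_right (by positivity)
  · filter_upwards [hη, hD, hf0.eventually (gt_mem_nhds (show eigMin B < eigMin B + δ / 2 by
      linarith))] with μ h hμ hfμ
    have hx1 : eigMin (Vᴴ * affine a (θ μ) * V) ≤ θ μ ⬝ᵥ z := by
      rw [hfz]; exact ritz_le_rayleigh (hA μ) hd hvl.1 hVv
    have hx2 := eigMin_le_ritz (hA μ) hd hV.1
    have hρ : rho (affine a (θ μ)) (V * W μ) ≤ R * ‖affine a (θ μ) - B‖ := by
      refine (h₃ _ _ (hU μ hμ)).trans ?_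
      rw [hR, mul_assoc, one_add_mul]
      gcongr
      exact hproj μ hμ
    refine (abs_min_sub_correction_sub_le (half_pos hδ0) ?_ (norm_nonneg _) hρ hx1
      (b := c₁ * ‖affine a (θ μ) - B‖ ^ 2) ?_).trans_eq ?_
    · linarith
    · linarith [(hmin μ).2]
    · ring

theorem hasFDerivAt_lambdaSLB {P N Q J l r d : ℕ} {D : Set (EuclideanSpace ℝ (Fin P))}
    {a : Fin Q → Matrix (Fin N) (Fin N) ℂ} (ha : ∀ q, (a q).IsHermitian)
    {θ : EuclideanSpace ℝ (Fin P) → Fin Q → ℝ} {sample : Fin J → EuclideanSpace ℝ (Fin P)}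
    (hr : 1 ≤ r) (hrl : r ≤ l) (hlN : l < N) {X : Fin J → Matrix (Fin N) (Fin l) ℂ}
    (hX : ∀ j, IsLowestEigenbasis (affine a (θ (sample j))) (X j))
    {V : Matrix (Fin N) (Fin d) ℂ} (hV : IsOrthonormalBasisOfSamples X V)
    {W : EuclideanSpace ℝ (Fin P) → Matrix (Fin d) (Fin r) ℂ}
    (hW : ∀ μ ∈ D, IsLowestEigenbasis (Vᴴ * affine a (θ μ) * V) (W μ))
    (hpoly : IsSimplePolytope a fun j => θ (sample j))
    {s : EuclideanSpace ℝ (Fin P) → Fin Q → Constraint Q J}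
    (hs : ∀ μ ∈ D, IsOptimalActiveSet a (fun j => θ (sample j)) (θ μ) (s μ))
    {i : Fin J} (hi : sample i ∈ interior D)
    (hθ : ∀ q, DifferentiableAt ℝ (fun μ => θ μ q) (sample i))
    (hsimple : IsSimpleEigenvalue (affine a (θ (sample i))) (eigMin (affine a (θ (sample i)))))
    (hgap : eig (affine a (θ (sample i))) r < eig (affine a (θ (sample i))) (r + 1)) :
    lambdaSLB a θ sample X V W s (sample i) = eigMin (affine a (θ (sample i))) ∧
      ∃ f' : EuclideanSpace ℝ (Fin P) →L[ℝ] ℝ,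
        HasFDerivAt (fun μ => eigMin (affine a (θ μ))) f' (sample i) ∧
        HasFDerivAt (lambdaSLB a θ sample X V W s) f' (sample i) := by
  obtain ⟨z, hz, C, h₁, h₂⟩ :=
    exists_sq_error ha hr hrl hlN hX hV hW hpoly hs hi hθ hsimple hgap
  have hf : DifferentiableAt ℝ (fun μ => θ μ ⬝ᵥ z) (sample i) :=
    DifferentiableAt.fun_sum fun q _ => (hθ q).mul_const (z q)
  have he := isBigO_norm_affine_sub a hθ
  have h₃ := eq_and_hasFDerivAt_of_sq_error hf.hasFDerivAt he h₂
  exact ⟨h₃.1.trans hz, _, (eq_and_hasFDerivAt_of_sq_error hf.hasFDerivAt he h₁).2, h₃.2⟩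

end LowerBound

end SubspaceSCM

theorem theorem3p5 {P N Q J l r d : ℕ}
    -- a Hermitian matrix function in affine linear decomposition on a compact parameter domain
    (D : Set (EuclideanSpace ℝ (Fin P))) (_hD : IsCompact D)
    (a : Fin Q → Matrix (Fin N) (Fin N) ℂ) (ha : ∀ q, (a q).IsHermitian)
    (θ : EuclideanSpace ℝ (Fin P) → Fin Q → ℝ)
    -- samples, with orthonormal eigenvectors for the `l` smallest eigenvalues
    (sample : Fin J → EuclideanSpace ℝ (Fin P)) (hsample : ∀ j, sample j ∈ D)
    (hr : 1 ≤ r) (hrl : r ≤ l) (hlN : l < N)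
    (X : Fin J → Matrix (Fin N) (Fin l) ℂ)
    (hX : ∀ j, SubspaceSCM.IsLowestEigenbasis (SubspaceSCM.affine a (θ (sample j))) (X j))
    -- an orthonormal basis of the span of the sampled eigenvectors
    (V : Matrix (Fin N) (Fin d) ℂ) (hV : SubspaceSCM.IsOrthonormalBasisOfSamples X V)
    -- any choice of orthonormal eigenvectors for the `r` smallest Ritz values
    (W : EuclideanSpace ℝ (Fin P) → Matrix (Fin d) (Fin r) ℂ)
    (hW : ∀ μ ∈ D,
      SubspaceSCM.IsLowestEigenbasis (Vᴴ * SubspaceSCM.affine a (θ μ) * V) (W μ))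
    -- the standing assumption on the polytope of the linear program
    (hpoly : SubspaceSCM.IsSimplePolytope a fun j => θ (sample j))
    -- any choice of active constraints at a minimizer of the linear program
    (s : EuclideanSpace ℝ (Fin P) → Fin Q → SubspaceSCM.Constraint Q J)
    (hs : ∀ μ ∈ D,
      SubspaceSCM.IsOptimalActiveSet a (fun j => θ (sample j)) (θ μ) (s μ))
    -- the assumptions on the sample point `μ_i`
    (i : Fin J) (hi : sample i ∈ interior D)
    (hθ : ∀ q, DifferentiableAt ℝ (fun μ => θ μ q) (sample i))
    (hsimple : SubspaceSCM.IsSimpleEigenvalue (SubspaceSCM.affine a (θ (sample i)))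
      (SubspaceSCM.eigMin (SubspaceSCM.affine a (θ (sample i)))))
    (hgap : SubspaceSCM.eig (SubspaceSCM.affine a (θ (sample i))) r <
      SubspaceSCM.eig (SubspaceSCM.affine a (θ (sample i))) (r + 1)) :
    SubspaceSCM.lambdaSLB a θ sample X V W s (sample i) =
        SubspaceSCM.eigMin (SubspaceSCM.affine a (θ (sample i))) ∧
      DifferentiableAt ℝ (fun μ => SubspaceSCM.eigMin (SubspaceSCM.affine a (θ μ))) (sample i) ∧
      DifferentiableAt ℝ (SubspaceSCM.lambdaSLB a θ sample X V W s) (sample i) ∧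
      gradient (SubspaceSCM.lambdaSLB a θ sample X V W s) (sample i) =
        gradient (fun μ => SubspaceSCM.eigMin (SubspaceSCM.affine a (θ μ))) (sample i) := by
  obtain ⟨h, f', h₁, h₂⟩ := SubspaceSCM.hasFDerivAt_lambdaSLB ha hr hrl hlN hX hV hW hpoly hs hi hθ
    hsimple hgap
  exact ⟨h, h₁.differentiableAt, h₂.differentiableAt, by
    rw [gradient, gradient, h₁.fderiv, h₂.fderiv]⟩
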